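/- Let $E$ be a real or complex Hilbert space and let $\Phi_S(E)$ be the set of bounded self-adjoint Fredholm operators on $E$, with the norm topology. For bounded self-adjoint $T,S$ write $T\ge S$ if $\langle (T-S)x,x\rangle\ge 0$ for all $x\in E$. Spectral flow. Let $L\colon[a,b]\to\Phi_S(E)$ be a norm-continuous path. Choose a subdivision $a=t_0\le t_1\le\dots\le t_N=b$ and numbers $\varepsilon_0,\dots,\varepsilon_{N-1}>0$ such that, for every $i$ and every $s\in[t_i,t_{i+1}]$, the operators $L_s\pm\varepsilon_i\,\mathrm{Id}$ are invertible and $L_s-\mu\,\mathrm{Id}$ is Fredholm for all $\mu\in[-\varepsilon_i,\varepsilon_i]$. Then the spectrum of $L_s$ in $[0,\varepsilon_i]$ consists of finitely many eigenvalues of finite multiplicity; let $n(L_s,\varepsilon_i)$ be their number, counted with multiplicity. If $L_a$ and $L_b$ are invertible, the spectral flow of $L$ is $$\sum_{i=0}^{N-1}\bigl(n(L_{t_{i+1}},\varepsilon_i)-n(L_{t_i},\varepsilon_i)\bigr)\in\mathbb Z .$$ For general endpoints, the (extended) spectral flow $\operatorname{sf}(L)$ is the spectral flow of the translated path $L+\delta\,\mathrm{Id}$,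 where $\delta>0$ is so small that for all $\mu\in(0,\delta]$ the operators $L_a+\mu\,\mathrm{Id}$ and $L_b+\mu\,\mathrm{Id}$ are invertible and $L_s+\mu\,\mathrm{Id}$ is Fredholm for every $s\in[a,b]$. Theorem. Let $a\le b$ and let $H\colon[0,1]\times[a,b]\to\Phi_S(E)$ be a norm-continuous map such that $H(\cdot,a)$ is non-increasing and $H(\cdot,b)$ is non-decreasing, that is, $H(t,a)\le H(s,a)$ and $H(s,b)\le H(t,b)$ whenever $0\le s\le t\le 1$. Then the extended spectral flows of $H(0,\cdot)$ and $H(1,\cdot)$ exist and do not depend on the choices of $\delta$, the subdivision and the $\varepsilon_i$, and $$\operatorname{sf} H(0,\cdot)\;\le\;\operatorname{sf} H(1,\cdot).$$ -/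

import Mathlib

section SpectralFlow

variable {𝕜 E : Type*} [RCLike 𝕜] [NormedAddCommGroup E] [InnerProductSpace 𝕜 E] [CompleteSpace E]

/-- The set `Φ_S(E)` of bounded self-adjoint Fredholm operators on the Hilbert space `E`. -/
def fredholmSelfAdjoint (𝕜 E : Type*) [RCLike 𝕜] [NormedAddCommGroup E] [InnerProductSpace 𝕜 E]
    [CompleteSpace E] : Set (E →L[𝕜] E) :=
  {T | IsSelfAdjoint T ∧ T.IsFredholm}

/-- The translate `T + μ Id` of an operator by a real multiple of the identity. -/
def shiftOp (T : E →L[𝕜] E) (μ : ℝ) : E →L[𝕜] E :=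
  T + (μ : 𝕜) • ContinuousLinearMap.id 𝕜 E

/-- The number of eigenvalues of `T` in `[0, ε]`, counted with multiplicity: the dimension of the
span of all eigenspaces of `T` with eigenvalue in `[0, ε]`. It is used only for self-adjoint `T`
such that `T - μ Id` is Fredholm for all `μ ∈ [0, ε]`. The spectrum of `T` in `[0, ε]` then consists
of finitely many eigenvalues of finite multiplicity, and the span is the range of the spectral
projection `χ_{[0, ε]}(T)`. -/
noncomputable def eigenvalueCount (T : E →L[𝕜] E) (ε : ℝ) : ℕ :=
  Module.finrank 𝕜
    (⨆ μ ∈ Set.Icc (0 : ℝ) ε, Module.End.eigenspace (T : E →ₗ[𝕜] E) (μ : 𝕜) : Submodule 𝕜 E)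

/-- `ε > 0` is a spectral window for the path `L` on `[c, d]`: for all `s ∈ [c, d]`, neither `ε` nor
`-ε` is in the spectrum of `L s`, and no point of `[-ε, ε]` is in its essential spectrum. -/
def IsSpectralWindow (L : ℝ → E →L[𝕜] E) (c d ε : ℝ) : Prop :=
  0 < ε ∧ ∀ s ∈ Set.Icc c d,
    IsUnit (shiftOp (L s) ε) ∧ IsUnit (shiftOp (L s) (-ε)) ∧
    ∀ μ ∈ Set.Icc (-ε) ε, (shiftOp (L s) μ).IsFredholm

/-- `n` is the spectral flow of the path `L` of self-adjoint Fredholm operators on `[a, b]`,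
computed from a subdivision `a = t 0 ≤ t 1 ≤ ⋯ ≤ t N = b` and spectral windows `ε i` on
`[t i, t (i + 1)]`: the number of eigenvalues that become nonnegative minus the number of those
that become negative. -/
def HasSpectralFlow (L : ℝ → E →L[𝕜] E) (a b : ℝ) (n : ℤ) : Prop :=
  ∃ (N : ℕ) (t ε : ℕ → ℝ), t 0 = a ∧ t N = b ∧
    (∀ i < N, t i ≤ t (i + 1) ∧ IsSpectralWindow L (t i) (t (i + 1)) (ε i)) ∧
    n = ∑ i ∈ Finset.range N,
      ((eigenvalueCount (L (t (i + 1))) (ε i) : ℤ) - (eigenvalueCount (L (t i)) (ε i) : ℤ))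

/-- `δ > 0` is small enough for the translation of the path `L` on `[a, b]`: for `0 < μ ≤ δ`, the
path `L + μ Id` consists of Fredholm operators and its endpoints are invertible. -/
def IsAdmissibleShift (L : ℝ → E →L[𝕜] E) (a b δ : ℝ) : Prop :=
  0 < δ ∧ ∀ μ ∈ Set.Ioc 0 δ,
    IsUnit (shiftOp (L a) μ) ∧ IsUnit (shiftOp (L b) μ) ∧
    ∀ s ∈ Set.Icc a b, (shiftOp (L s) μ).IsFredholm

/-- `n` is the extended spectral flow of the path `L` on `[a, b]`, whose endpoints need not be
invertible: the spectral flow of the translated path `L + δ Id`, for a small `δ > 0`. -/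
def HasExtendedSpectralFlow (L : ℝ → E →L[𝕜] E) (a b : ℝ) (n : ℤ) : Prop :=
  ∃ δ : ℝ, IsAdmissibleShift L a b δ ∧ HasSpectralFlow (fun s => shiftOp (L s) δ) a b n

open Classical in
/-- The extended spectral flow `sf(L)` of a path `L` on `[a, b]`. -/
noncomputable def extendedSpectralFlow (L : ℝ → E →L[𝕜] E) (a b : ℝ) : ℤ :=
  if h : ∃ n, HasExtendedSpectralFlow L a b n then h.choose else 0

end SpectralFlow

/-! Add one small `δ > 0` to every operator of the rectangle, so that all of them stay Fredholm and
`δ` is admissible for both rows `t = 0` and `t = 1`. The signed count of eigenvalues crossing zero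
cancels around the boundary of the rectangle. Hence the flow along the row `t = 1` minus the flow
along `t = 0` equals the crossing count along the column `s = b` minus the count along `s = a`. On
`s = b` the operators grow, so that count is nonnegative; on `s = a` they decrease, so it is
nonpositive.

Crossing counts are encoded by a spectral potential (`IsSpectralPotential`), an integer function
whose local increments are the changes of `eigenvalueCount` in any window. It makes sense because
local changes do not depend on the window (`IsWindowAt.eventually_eigenvalueCount_sub`). The flow of
a path is the total increment of a potential (`IsSpectralPotential.eq_sub`), so it is independent of
subdivision and windows. The boundary identity is `HasSpectralFlow.sub_eq_of_homotopy`; applied to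
`L s + μ Id`, where the ends stay invertible, it also gives independence of `δ`.

The analysis uses norm estimates instead of functional calculus. On the span of the eigenspaces in a
window `[-ε, ε]` the operator has norm less than `ε`, and on the orthogonal complement it is bounded
below by more than `ε`. This gap makes the dimension of the span locally constant. The sign of the
crossings under monotone perturbation comes from `IsWindowAt.eventually_mem_ker`. -/

open Filter Topology

/-! ### Self-adjoint Fredholm operators: lower bounds and stability. -/

section SelfAdjointOperators

variable {𝕜 E : Type*} [RCLike 𝕜] [NormedAddCommGroup E] [InnerProductSpace 𝕜 E]

theorem shiftOp_apply (T : E →L[𝕜] E) (μ : ℝ) (x : E) : shiftOp T μ x = T x + (μ : 𝕜) • x := rfl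

theorem shiftOp_zero (T : E →L[𝕜] E) : shiftOp T 0 = T := by
  ext x; simp [shiftOp_apply]

theorem shiftOp_shiftOp (T : E →L[𝕜] E) (μ ν : ℝ) :
    shiftOp (shiftOp T μ) ν = shiftOp T (μ + ν) := by
  ext x; simp [shiftOp_apply, add_smul, add_assoc]

theorem continuous_shiftOp : Continuous fun p : (E →L[𝕜] E) × ℝ => shiftOp p.1 p.2 :=
  by
  unfold shiftOp
  fun_prop

theorem mem_eigenspace_iff_apply {T : E →L[𝕜] E} {μ : ℝ} {x : E} :
    x ∈ Module.End.eigenspace (T : E →ₗ[𝕜] E) (μ : 𝕜) ↔ T x = (μ : 𝕜) • x :=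
  Module.End.mem_eigenspace_iff

theorem eigenspace_eq_ker_shiftOp (T : E →L[𝕜] E) (μ : ℝ) :
    Module.End.eigenspace (T : E →ₗ[𝕜] E) (μ : 𝕜) = (shiftOp T (-μ)).ker := by
  ext x
  rw [mem_eigenspace_iff_apply, LinearMap.mem_ker]
  simp [shiftOp_apply, ← sub_eq_add_neg, sub_eq_zero]

variable [CompleteSpace E]

theorem IsSelfAdjoint.shiftOp {T : E →L[𝕜] E} (hT : IsSelfAdjoint T) (μ : ℝ) :
    IsSelfAdjoint (shiftOp T μ) := by
  refine hT.add ?_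
  rw [ContinuousLinearMap.isSelfAdjoint_iff_isSymmetric]
  intro x y
  simp [inner_smul_left, inner_smul_right]

theorem IsSelfAdjoint.inner_map_comm {T : E →L[𝕜] E} (hT : IsSelfAdjoint T) (x y : E) :
    inner 𝕜 (T x) y = inner 𝕜 x (T y) :=
  hT.isSymmetric x y

/-- A self-adjoint operator that is bounded below is invertible. -/
theorem IsSelfAdjoint.isUnit_of_le_norm_map {T : E →L[𝕜] E} (hT : IsSelfAdjoint T) {r : ℝ}
    (hr : 0 < r) (h : ∀ x, r * ‖x‖ ≤ ‖T x‖) : IsUnit T := by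
  -- The quadratic form of `T` itself may be indefinite, but that of `T * T` is `‖T x‖ ^ 2`, which
  -- is bounded below.
  rw [← isUnit_pow_iff two_ne_zero, sq]
  refine ContinuousLinearMap.isUnit_of_forall_le_norm_inner_map (𝕜 := 𝕜) (T * T)
    (c := ⟨r ^ 2, by positivity⟩) (pow_pos hr 2 : (0 : ℝ) < r ^ 2) fun x => ?_
  calc ‖x‖ ^ 2 * r ^ 2 = (r * ‖x‖) ^ 2 := by ring
    _ ≤ ‖T x‖ ^ 2 := by gcongr; exact h x
    _ = ‖inner 𝕜 (T (T x)) x‖ := by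
      rw [hT.inner_map_comm, inner_self_eq_norm_sq_to_K]
      simp

theorem ContinuousLinearMap.IsFredholm.exists_le_norm_map {T : E →L[𝕜] E} (hT : T.IsFredholm) :
    ∃ r > 0, ∀ x ∈ T.kerᗮ, r * ‖x‖ ≤ ‖T x‖ := by
  have := hT.finite_ker
  obtain ⟨C, hC⟩ := hT.closedComplemented_range.exists_isTopCompl
  let pkg := hT.fredholmPackage T.ker.isTopCompl_orthogonal hC
  set e := (pkg.equiv.symm : pkg.decCodom.X₁ →L[𝕜] pkg.decDom.X₁)
  refine ⟨(‖e‖ + 1)⁻¹, by positivity, fun x hx => ?_⟩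
  rw [inv_mul_le_iff₀ (by positivity)]
  let y : pkg.decDom.X₁ := ⟨x, hx⟩
  have h1 : ‖pkg.equiv y‖ = ‖T x‖ := by
    have := DFunLike.congr_fun pkg.equiv_eq_restrict y
    exact congrArg (fun z : pkg.decCodom.X₁ => ‖(z : E)‖) this
  have h2 : ‖x‖ ≤ ‖e‖ * ‖T x‖ := by
    have := e.le_opNorm (pkg.equiv y)
    rw [h1] at this
    simpa [e] using this
  nlinarith [norm_nonneg (T x)]

theorem IsSelfAdjoint.map_mem_orthogonal {T : E →L[𝕜] E} (hT : IsSelfAdjoint T)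
    {V : Submodule 𝕜 E} (hV : ∀ x ∈ V, T x ∈ V) {x : E} (hx : x ∈ Vᗮ) : T x ∈ Vᗮ := by
  rw [Submodule.mem_orthogonal] at hx ⊢
  intro u hu
  rw [← hT.inner_map_comm]
  exact hx _ (hV u hu)

theorem IsSelfAdjoint.map_mem_orthogonal_ker {T : E →L[𝕜] E} (hT : IsSelfAdjoint T) (x : E) :
    T x ∈ T.kerᗮ := by
  rw [Submodule.mem_orthogonal]
  intro u hu
  rw [← hT.inner_map_comm, show T u = 0 from hu, inner_zero_left]

omit [CompleteSpace E] in
theorem norm_sq_add_of_mem_orthogonal {V : Submodule 𝕜 E} {x y : E} (hx : x ∈ V) (hy : y ∈ Vᗮ) :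
    ‖x + y‖ ^ 2 = ‖x‖ ^ 2 + ‖y‖ ^ 2 := by
  have := norm_add_sq_eq_norm_sq_add_norm_sq_of_inner_eq_zero (𝕜 := 𝕜) x y
    (Submodule.inner_right_of_mem_orthogonal hx hy)
  simpa [sq] using this

omit [CompleteSpace E] in
/-- An operator that leaves `V` and `Vᗮ` invariant and is bounded below on both is bounded below. -/
theorem le_norm_map_of_orthogonal {S : E →L[𝕜] E} {V : Submodule 𝕜 E}
    [V.HasOrthogonalProjection] {r : ℝ} (hr : 0 ≤ r)
    (hV : ∀ x ∈ V, S x ∈ V ∧ r * ‖x‖ ≤ ‖S x‖)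
    (hV' : ∀ x ∈ Vᗮ, S x ∈ Vᗮ ∧ r * ‖x‖ ≤ ‖S x‖) (x : E) : r * ‖x‖ ≤ ‖S x‖ := by
  obtain ⟨y, hy, z, hz, rfl⟩ := V.exists_add_mem_mem_orthogonal x
  refine le_of_sq_le_sq ?_ (norm_nonneg _)
  rw [map_add, mul_pow, norm_sq_add_of_mem_orthogonal hy hz,
    norm_sq_add_of_mem_orthogonal (hV y hy).1 (hV' z hz).1, mul_add, ← mul_pow, ← mul_pow]
  gcongr
  · exact (hV y hy).2
  · exact (hV' z hz).2

/-- Operators close to a self-adjoint Fredholm operator are Fredholm. -/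
theorem ContinuousLinearMap.IsFredholm.eventually_isFredholm {T : E →L[𝕜] E}
    (hT : IsSelfAdjoint T) (hF : T.IsFredholm) : ∀ᶠ S in 𝓝 T, S.IsFredholm := by
  have := hF.finite_ker
  obtain ⟨r, hr, h⟩ := hF.exists_le_norm_map
  set P : E →L[𝕜] E := T.ker.starProjection
  have hP1 : ∀ x ∈ T.ker, P x = x := fun x hx => Submodule.starProjection_eq_self_iff.2 hx
  have hP2 : ∀ x ∈ T.kerᗮ, P x = 0 := fun x hx =>
    (Submodule.starProjection_apply_eq_zero_iff _).2 hx
  -- `P` acts as the identity on the kernel and vanishes on its complement, where `T` is bounded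
  -- below. Invertibility of `S + P` persists for `S` near `T`, and its inverse inverts `S` up to
  -- finite rank.
  have hu : IsUnit (T + P) := by
    refine IsSelfAdjoint.isUnit_of_le_norm_map (hT.add ?_) (lt_min hr one_pos)
      (le_norm_map_of_orthogonal (V := T.ker) (lt_min hr one_pos).le (fun x hx => ?_)
        fun x hx => ?_)
    · exact isSelfAdjoint_starProjection _
    · have : (T + P) x = x := by
        rw [_root_.add_apply, hP1 x hx, show T x = 0 from hx, zero_add]
      rw [this]
      exact ⟨hx, mul_le_of_le_one_left (norm_nonneg _) (min_le_right _ _)⟩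
    · have : (T + P) x = T x := by rw [_root_.add_apply, hP2 x hx, add_zero]
      rw [this]
      exact ⟨hT.map_mem_orthogonal_ker x,
        (mul_le_mul_of_nonneg_right (min_le_left _ _) (norm_nonneg _)).trans (h x hx)⟩
  have hc : ∀ᶠ S in 𝓝 T, IsUnit (S + P) :=
    (continuous_id.add continuous_const).continuousAt.eventually (Units.isOpen.mem_nhds hu)
  filter_upwards [hc] with S ⟨u, hS⟩
  have hfin : P.toLinearMap.HasFiniteRange := by
    refine LinearMap.hasFiniteRange_iff_range.2 ?_
    rw [← Module.Finite.iff_fg]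
    exact Submodule.finiteDimensional_of_le (S₂ := T.ker) fun x ⟨y, hy⟩ =>
      hy ▸ Submodule.starProjection_apply_mem _ _
  set v : E →L[𝕜] E := ↑u⁻¹
  have h1 : ∀ x, v (S x) = x - v (P x) := fun x => by
    have : v ((S + P) x) = x := by
      rw [← hS]
      exact DFunLike.congr_fun u.inv_mul x
    rw [eq_sub_iff_add_eq, ← map_add]
    exact this
  have h2 : ∀ x, S (v x) = x - P (v x) := fun x => by
    have : (S + P) (v x) = x := by
      rw [← hS]
      exact DFunLike.congr_fun u.mul_inv x
    rw [eq_sub_iff_add_eq]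
    exact this
  refine ContinuousLinearMap.IsFredholm.of_isQuasiInverse (v := v) ⟨?_, ?_⟩
  · refine LinearMap.FiniteRangeSetoid.equiv_iff_hasFiniteRange.2 ?_
    have : (v : E →ₗ[𝕜] E) ∘ₗ (S : E →ₗ[𝕜] E) - .id = -((v : E →ₗ[𝕜] E) ∘ₗ (P : E →ₗ[𝕜] E)) := by
      ext x
      simp [h1]
    rw [this]
    exact (hfin.comp_left _).neg
  · refine LinearMap.FiniteRangeSetoid.equiv_iff_hasFiniteRange.2 ?_
    have : (S : E →ₗ[𝕜] E) ∘ₗ (v : E →ₗ[𝕜] E) - .id = -((P : E →ₗ[𝕜] E) ∘ₗ (v : E →ₗ[𝕜] E)) := by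
      ext x
      simp [h2]
    rw [this]
    exact (hfin.comp_right _).neg

end SelfAdjointOperators

/-! ### Spans of eigenspaces and spectral windows. -/

section SpectralWindow

variable {𝕜 E : Type*} [RCLike 𝕜] [NormedAddCommGroup E] [InnerProductSpace 𝕜 E]

/-- The span of all eigenspaces of `T` with real eigenvalue in `[α, β]`. -/
def eigenSpan (T : E →L[𝕜] E) (α β : ℝ) : Submodule 𝕜 E :=
  ⨆ μ ∈ Set.Icc α β, Module.End.eigenspace (T : E →ₗ[𝕜] E) (μ : 𝕜)

theorem eigenvalueCount_eq (T : E →L[𝕜] E) (ε : ℝ) :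
    eigenvalueCount T ε = Module.finrank 𝕜 (eigenSpan T 0 ε) := rfl

theorem eigenspace_le_eigenSpan (T : E →L[𝕜] E) {α β μ : ℝ} (hμ : μ ∈ Set.Icc α β) :
    Module.End.eigenspace (T : E →ₗ[𝕜] E) (μ : 𝕜) ≤ eigenSpan T α β :=
  le_iSup₂_of_le μ hμ le_rfl

theorem eigenSpan_le_iff {T : E →L[𝕜] E} {α β : ℝ} {V : Submodule 𝕜 E} :
    eigenSpan T α β ≤ V ↔ ∀ μ ∈ Set.Icc α β, ∀ x, T x = (μ : 𝕜) • x → x ∈ V := by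
  simp only [eigenSpan, iSup_le_iff]
  exact forall₂_congr fun μ _ => forall_congr' fun x => by rw [mem_eigenspace_iff_apply]

theorem mem_eigenSpan {T : E →L[𝕜] E} {α β μ : ℝ} (hμ : μ ∈ Set.Icc α β) {x : E}
    (hx : T x = (μ : 𝕜) • x) : x ∈ eigenSpan T α β :=
  eigenspace_le_eigenSpan T hμ (mem_eigenspace_iff_apply.2 hx)

theorem eigenSpan_mono (T : E →L[𝕜] E) {α β α' β' : ℝ} (hα : α' ≤ α) (hβ : β ≤ β') :
    eigenSpan T α β ≤ eigenSpan T α' β' :=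
  eigenSpan_le_iff.2 fun _ hμ _ hx => mem_eigenSpan ⟨hα.trans hμ.1, hμ.2.trans hβ⟩ hx

theorem eigenSpan_sup (T : E →L[𝕜] E) {α β γ : ℝ} (h1 : α ≤ β) (h2 : β ≤ γ) :
    eigenSpan T α γ = eigenSpan T α β ⊔ eigenSpan T β γ := by
  refine le_antisymm (eigenSpan_le_iff.2 fun μ hμ x hx => ?_)
    (sup_le (eigenSpan_mono T le_rfl h2) (eigenSpan_mono T h1 le_rfl))
  rcases le_total μ β with h | h
  · exact Submodule.mem_sup_left (mem_eigenSpan ⟨hμ.1, h⟩ hx)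
  · exact Submodule.mem_sup_right (mem_eigenSpan ⟨h, hμ.2⟩ hx)

theorem eigenSpan_shiftOp (T : E →L[𝕜] E) (α β ν : ℝ) :
    eigenSpan (shiftOp T ν) α β = eigenSpan T (α - ν) (β - ν) := by
  refine le_antisymm (eigenSpan_le_iff.2 fun μ hμ x hx => ?_)
    (eigenSpan_le_iff.2 fun μ hμ x hx => ?_)
  · refine mem_eigenSpan (μ := μ - ν) ⟨by linarith [hμ.1], by linarith [hμ.2]⟩ ?_
    rw [shiftOp_apply] at hx
    rw [eq_sub_of_add_eq hx]
    simp [sub_smul]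
  · refine mem_eigenSpan (μ := μ + ν) ⟨by linarith [hμ.1], by linarith [hμ.2]⟩ ?_
    rw [shiftOp_apply, hx]
    simp [add_smul]

theorem map_mem_eigenSpan {T : E →L[𝕜] E} {α β : ℝ} {x : E} (hx : x ∈ eigenSpan T α β) :
    T x ∈ eigenSpan T α β := by
  have : eigenSpan T α β ≤ (eigenSpan T α β).comap (T : E →ₗ[𝕜] E) :=
    eigenSpan_le_iff.2 fun μ hμ x hx => by
      rw [Submodule.mem_comap]
      change T x ∈ _
      rw [hx]
      exact Submodule.smul_mem _ _ (mem_eigenSpan hμ hx)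
  exact this hx

/-- `ε > 0` is a spectral window for the operator `T`: neither `ε` nor `-ε` is in the spectrum of
`T`, and no point of `[-ε, ε]` is in its essential spectrum. -/
structure IsWindowAt (T : E →L[𝕜] E) (ε : ℝ) : Prop where
  pos : 0 < ε
  isUnit_add : IsUnit (shiftOp T ε)
  isUnit_sub : IsUnit (shiftOp T (-ε))
  isFredholm : ∀ μ ∈ Set.Icc (-ε) ε, (shiftOp T μ).IsFredholm

theorem eq_zero_of_isUnit_shiftOp {T : E →L[𝕜] E} {μ : ℝ} (h : IsUnit (shiftOp T (-μ))) {x : E}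
    (hx : T x = (μ : 𝕜) • x) : x = 0 := by
  obtain ⟨u, hu⟩ := h
  have h1 : shiftOp T (-μ) x = 0 := by simp [shiftOp_apply, hx]
  have h2 : (↑u⁻¹ : E →L[𝕜] E) (shiftOp T (-μ) x) = x := by
    rw [← hu]
    exact DFunLike.congr_fun u.inv_mul x
  rw [← h2, h1, map_zero]

/-- The orthogonal projection onto `W` is injective on `V`. -/
theorem finrank_le_finrank_of_disjoint_orthogonal {V W : Submodule 𝕜 E} [FiniteDimensional 𝕜 V]
    [FiniteDimensional 𝕜 W] (h : ∀ x ∈ V, x ∈ Wᗮ → x = 0) :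
    Module.finrank 𝕜 V ≤ Module.finrank 𝕜 W := by
  let f : V →ₗ[𝕜] W := (W.orthogonalProjectionOnto : E →ₗ[𝕜] W) ∘ₗ V.subtype
  refine LinearMap.finrank_le_finrank_of_injective (f := f) ?_
  rw [← LinearMap.ker_eq_bot, LinearMap.ker_eq_bot']
  intro x hx
  refine Subtype.ext (h x x.2 ?_)
  exact Submodule.orthogonalProjectionOnto_eq_zero_iff.1 hx

variable [CompleteSpace E]

/-- Zero is at most an isolated point of the spectrum of a self-adjoint Fredholm operator. -/
theorem ContinuousLinearMap.IsFredholm.exists_isUnit_shiftOp {T : E →L[𝕜] E}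
    (hT : IsSelfAdjoint T) (hF : T.IsFredholm) :
    ∃ r > 0, ∀ μ : ℝ, μ ≠ 0 → |μ| < r → IsUnit (shiftOp T μ) := by
  have := hF.finite_ker
  obtain ⟨r, hr, h⟩ := hF.exists_le_norm_map
  refine ⟨r, hr, fun μ hμ hμr => ?_⟩
  -- The shifted operator is multiplication by `μ` on the kernel, and loses at most `|μ|` from the
  -- lower bound `r` on the complement.
  have hm : 0 < min |μ| (r - |μ|) := lt_min (abs_pos.2 hμ) (by linarith)
  refine (hT.shiftOp μ).isUnit_of_le_norm_map hm
    (le_norm_map_of_orthogonal (V := T.ker) hm.le (fun x hx => ?_) fun x hx => ?_)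
  · have : shiftOp T μ x = (μ : 𝕜) • x := by
      rw [shiftOp_apply, show T x = 0 from hx, zero_add]
    rw [this, norm_smul, RCLike.norm_ofReal]
    exact ⟨Submodule.smul_mem _ _ hx,
      mul_le_mul_of_nonneg_right (min_le_left _ _) (norm_nonneg _)⟩
  · refine ⟨add_mem (hT.map_mem_orthogonal_ker x) (Submodule.smul_mem _ _ hx), ?_⟩
    have h1 : ‖T x‖ ≤ ‖shiftOp T μ x‖ + |μ| * ‖x‖ := by
      have := norm_sub_le (shiftOp T μ x) ((μ : 𝕜) • x)
      rwa [shiftOp_apply, add_sub_cancel_right, norm_smul, RCLike.norm_ofReal,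
        ← shiftOp_apply] at this
    have h2 := mul_le_mul_of_nonneg_right (min_le_right |μ| (r - |μ|)) (norm_nonneg x)
    linarith [h x hx]

theorem isFredholm_shiftOp_eventually {T : E →L[𝕜] E} {μ : ℝ} (hT : IsSelfAdjoint T)
    (h : (shiftOp T μ).IsFredholm) : ∀ᶠ p : (E →L[𝕜] E) × ℝ in 𝓝 (T, μ),
      (shiftOp p.1 p.2).IsFredholm :=
  continuous_shiftOp.continuousAt.eventually (h.eventually_isFredholm (hT.shiftOp μ))

/-- Every self-adjoint Fredholm operator has arbitrarily small spectral windows which contain at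
most the point zero of its spectrum. -/
theorem ContinuousLinearMap.IsFredholm.exists_isWindowAt {T : E →L[𝕜] E}
    (hT : IsSelfAdjoint T) (hF : T.IsFredholm) :
    ∃ ε, IsWindowAt T ε ∧ eigenSpan T (-ε) ε ≤ T.ker := by
  obtain ⟨r, hr, h⟩ := hF.exists_isUnit_shiftOp hT
  have h1 : ∀ᶠ μ : ℝ in 𝓝 0, (shiftOp T μ).IsFredholm := by
    have := isFredholm_shiftOp_eventually (μ := 0) hT (by rwa [shiftOp_zero])
    exact (by fun_prop : Continuous fun μ : ℝ => (T, μ)).continuousAt.eventually this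
  obtain ⟨ρ, hρ, h2⟩ := Metric.eventually_nhds_iff.1 h1
  obtain ⟨ε, hε, hε'⟩ := exists_between (lt_min hr hρ)
  rw [lt_min_iff] at hε'
  refine ⟨ε, ⟨hε, h _ hε.ne' (by rw [abs_of_pos hε]; exact hε'.1),
    h _ (neg_ne_zero.2 hε.ne') (by rw [abs_neg, abs_of_pos hε]; exact hε'.1), fun μ hμ => h2 ?_⟩,
    eigenSpan_le_iff.2 fun μ hμ x hx => ?_⟩
  · rw [Real.dist_eq, sub_zero]
    exact (abs_le.2 hμ).trans_lt hε'.2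
  · rcases eq_or_ne μ 0 with rfl | h0
    · simpa using hx
    · have : x = 0 := eq_zero_of_isUnit_shiftOp (h _ (neg_ne_zero.2 h0)
        (by rw [abs_neg]; exact (abs_le.2 hμ).trans_lt hε'.1)) hx
      rw [this]
      exact zero_mem _

namespace IsWindowAt

variable {T : E →L[𝕜] E} {ε : ℝ}

/-- Every shift in the window is Fredholm, so non-invertible shifts are isolated by
`exists_isUnit_shiftOp`; compactness of the window leaves finitely many. -/
theorem finite_setOf_not_isUnit (hT : IsSelfAdjoint T) (h : IsWindowAt T ε) :
    {μ ∈ Set.Icc (-ε) ε | ¬ IsUnit (shiftOp T μ)}.Finite := by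
  have h1 : ∀ μ ∈ Set.Icc (-ε) ε, {ν | IsUnit (shiftOp T ν)} ∪ {μ} ∈ 𝓝 μ := fun μ hμ => by
    obtain ⟨r, hr, hu⟩ := (h.isFredholm μ hμ).exists_isUnit_shiftOp (hT.shiftOp μ)
    filter_upwards [Metric.ball_mem_nhds μ hr] with ν hν
    rcases eq_or_ne ν μ with rfl | hne
    · exact Or.inr rfl
    · left
      have := hu (ν - μ) (sub_ne_zero.2 hne) hν
      rwa [shiftOp_shiftOp, add_sub_cancel] at this
  obtain ⟨t, ht, hcov⟩ := isCompact_Icc.elim_nhds_subcover _ h1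
  refine t.finite_toSet.subset fun μ hμ => ?_
  obtain ⟨ν, hν, h2⟩ := Set.mem_iUnion₂.1 (hcov hμ.1)
  rcases h2 with h2 | h2
  · exact absurd h2 hμ.2
  · rw [Set.mem_singleton_iff.1 h2]
    exact hν

theorem exists_finset (hT : IsSelfAdjoint T) (h : IsWindowAt T ε) :
    ∃ s : Finset ℝ, (∀ μ ∈ s, |μ| < ε) ∧
      eigenSpan T (-ε) ε = ⨆ μ ∈ s, Module.End.eigenspace (T : E →ₗ[𝕜] E) (μ : 𝕜) := by
  -- An eigenvalue `μ` corresponds to the shift by `-μ`, hence the reflection. The edges of the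
  -- window are invertible shifts, which gives `|μ| < ε`.
  have hfin := (h.finite_setOf_not_isUnit hT).image Neg.neg
  refine ⟨hfin.toFinset, fun μ hμ => ?_, le_antisymm (eigenSpan_le_iff.2 fun μ hμ x hx => ?_)
    (iSup₂_le fun μ hμ => ?_)⟩
  · obtain ⟨ν, ⟨hν, hu⟩, rfl⟩ := hfin.mem_toFinset.1 hμ
    rw [abs_neg, abs_lt]
    refine ⟨lt_of_le_of_ne hν.1 ?_, lt_of_le_of_ne hν.2 ?_⟩
    · rintro rfl
      exact hu h.isUnit_sub
    · rintro rfl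
      exact hu h.isUnit_add
  · by_cases hu : IsUnit (shiftOp T (-μ))
    · rw [eq_zero_of_isUnit_shiftOp hu hx]
      exact zero_mem _
    · refine Submodule.mem_iSup_of_mem μ (Submodule.mem_iSup_of_mem ?_
        (mem_eigenspace_iff_apply.2 hx))
      rw [Set.Finite.mem_toFinset]
      exact ⟨-μ, ⟨⟨by linarith [hμ.2], by linarith [hμ.1]⟩, hu⟩, neg_neg μ⟩
  · obtain ⟨ν, ⟨hν, hu⟩, rfl⟩ := hfin.mem_toFinset.1 hμ
    exact eigenspace_le_eigenSpan T ⟨by linarith [hν.2], by linarith [hν.1]⟩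

theorem finiteDimensional (hT : IsSelfAdjoint T) (h : IsWindowAt T ε) :
    FiniteDimensional 𝕜 (eigenSpan T (-ε) ε) := by
  obtain ⟨s, hs, heq⟩ := h.exists_finset hT
  rw [heq, iSup_subtype']
  have : ∀ μ : {μ // μ ∈ s},
      FiniteDimensional 𝕜 (Module.End.eigenspace (T : E →ₗ[𝕜] E) ((μ : ℝ) : 𝕜)) := fun μ => by
    rw [eigenspace_eq_ker_shiftOp]
    have := abs_lt.1 (hs μ μ.2)
    exact (h.isFredholm _ ⟨by linarith, by linarith⟩).finite_ker
  exact Submodule.finiteDimensional_iSup _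

theorem finiteDimensional_of_le (hT : IsSelfAdjoint T) (h : IsWindowAt T ε) {α β : ℝ}
    (hα : -ε ≤ α) (hβ : β ≤ ε) : FiniteDimensional 𝕜 (eigenSpan T α β) :=
  have := h.finiteDimensional hT
  Submodule.finiteDimensional_of_le (eigenSpan_mono T hα hβ)

/-- On the span of the eigenspaces inside the window, `T` is bounded by less than `ε`. -/
theorem exists_norm_map_le (hT : IsSelfAdjoint T) (h : IsWindowAt T ε) :
    ∃ ρ < ε, ∀ x ∈ eigenSpan T (-ε) ε, ‖T x‖ ≤ ρ * ‖x‖ := by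
  obtain ⟨s, hs, heq⟩ := h.exists_finset hT
  obtain ⟨ρ, hρ0, hρ, hsρ⟩ : ∃ ρ, 0 ≤ ρ ∧ ρ < ε ∧ ∀ μ ∈ s, |μ| ≤ ρ := by
    -- Inserting `0` makes the maximum exist and nonnegative even when there are no eigenvalues.
    have hne : (insert 0 s).Nonempty := ⟨0, Finset.mem_insert_self _ _⟩
    refine ⟨(insert 0 s).sup' hne abs, ?_, ?_, fun μ hμ =>
      Finset.le_sup' abs (Finset.mem_insert_of_mem hμ)⟩
    · exact (abs_nonneg 0).trans (Finset.le_sup' abs (Finset.mem_insert_self 0 s))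
    · rw [Finset.sup'_lt_iff]
      intro μ hμ
      rcases Finset.mem_insert.1 hμ with rfl | hμ
      · simpa using h.pos
      · exact hs μ hμ
  refine ⟨ρ, hρ, fun x hx => ?_⟩
  rw [heq, Submodule.mem_iSup_finset_iff_exists_sum] at hx
  obtain ⟨v, rfl⟩ := hx
  have horth := (hT.isSymmetric.orthogonalFamily_eigenspaces).comp
    (RCLike.ofReal_injective (K := 𝕜))
  refine le_of_sq_le_sq ?_ (by positivity)
  have h1 := horth.norm_sum v s
  have h2 := horth.norm_sum (fun μ => (μ : 𝕜) • v μ) s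
  have h3 : T (∑ μ ∈ s, (v μ : E)) = ∑ μ ∈ s, (((μ : 𝕜) • v μ :
      Module.End.eigenspace (T : E →ₗ[𝕜] E) (μ : 𝕜)) : E) := by
    rw [map_sum]
    exact Finset.sum_congr rfl fun μ _ => mem_eigenspace_iff_apply.1 (v μ).2
  rw [h3, mul_pow]
  refine h2.le.trans (le_trans ?_ (mul_le_mul_of_nonneg_left h1.ge (sq_nonneg ρ)))
  rw [Finset.mul_sum]
  refine Finset.sum_le_sum fun μ hμ => ?_
  rw [norm_smul, RCLike.norm_ofReal, mul_pow]
  gcongr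
  exact hsρ μ hμ

end IsWindowAt

end SpectralWindow

/-! ### The spectral gap at the window edges and its consequences for eigenvalue counts. -/

section SpectralWindow

variable {𝕜 E : Type*} [RCLike 𝕜] [NormedAddCommGroup E] [InnerProductSpace 𝕜 E] [CompleteSpace E]

omit [CompleteSpace E] in
theorem ContinuousLinearMap.IsFredholm.neg {T : E →L[𝕜] E} (hT : T.IsFredholm) :
    (-T).IsFredholm := by
  obtain ⟨v, hv⟩ := hT.exists_isQuasiInverse
  refine ContinuousLinearMap.IsFredholm.of_isQuasiInverse (v := -v) ?_
  have h1 : ((-v : E →L[𝕜] E) : E →ₗ[𝕜] E) ∘ₗ ((-T : E →L[𝕜] E) : E →ₗ[𝕜] E) =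
      (v : E →ₗ[𝕜] E) ∘ₗ (T : E →ₗ[𝕜] E) := by
    ext; simp
  have h2 : ((-T : E →L[𝕜] E) : E →ₗ[𝕜] E) ∘ₗ ((-v : E →L[𝕜] E) : E →ₗ[𝕜] E) =
      (T : E →ₗ[𝕜] E) ∘ₗ (v : E →ₗ[𝕜] E) := by
    ext; simp
  simpa only [LinearMap.IsQuasiInverse, LinearMap.IsLeftQuasiInverse,
    LinearMap.IsRightQuasiInverse, h1, h2] using hv

/-- A form of the Cauchy-Schwarz inequality for the quadratic form of `D`, which only has to be
nonnegative at one vector. -/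
theorem IsSelfAdjoint.norm_map_sq_le {D : E →L[𝕜] E} (hD : IsSelfAdjoint D) {d : ℝ} (hd0 : 0 < d)
    (hd : ‖D‖ ≤ d) {x : E}
    (hpos : 0 ≤ RCLike.re (inner 𝕜 (D (x - ((d⁻¹ : ℝ) : 𝕜) • D x)) (x - ((d⁻¹ : ℝ) : 𝕜) • D x))) :
    ‖D x‖ ^ 2 ≤ d * RCLike.re (inner 𝕜 (D x) x) := by
  set t := d⁻¹
  have ht : 0 < t := inv_pos.2 hd0
  have htd : d * t = 1 := mul_inv_cancel₀ hd0.ne'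
  -- The form is expanded at `x - t D x` with `t = 1 / d`; the last term is at most `t * ‖D x‖ ^ 2`
  -- because `‖D‖ ≤ d`.
  have h2 : RCLike.re (inner 𝕜 (D (x - (t : 𝕜) • D x)) (x - (t : 𝕜) • D x)) =
      RCLike.re (inner 𝕜 (D x) x) - 2 * t * ‖D x‖ ^ 2
        + t ^ 2 * RCLike.re (inner 𝕜 (D (D x)) (D x)) := by
    have e1 : inner 𝕜 (D (D x)) x = inner 𝕜 (D x) (D x) := hD.inner_map_comm _ _
    simp only [map_sub, map_smul, inner_sub_left, inner_sub_right, inner_smul_left,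
      inner_smul_right, e1, inner_self_eq_norm_sq_to_K, RCLike.conj_ofReal, ← RCLike.ofReal_pow,
      RCLike.re_ofReal_mul, RCLike.ofReal_re]
    ring
  have h3 : RCLike.re (inner 𝕜 (D (D x)) (D x)) ≤ d * ‖D x‖ ^ 2 := by
    calc RCLike.re (inner 𝕜 (D (D x)) (D x)) ≤ ‖D (D x)‖ * ‖D x‖ := re_inner_le_norm _ _
      _ ≤ (d * ‖D x‖) * ‖D x‖ := by
        gcongr
        exact (D.le_opNorm _).trans (by gcongr)
      _ = _ := by ring
  have h5 : t ^ 2 * RCLike.re (inner 𝕜 (D (D x)) (D x)) ≤ t * ‖D x‖ ^ 2 := by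
    calc _ ≤ t ^ 2 * (d * ‖D x‖ ^ 2) := by gcongr
      _ = (d * t) * t * ‖D x‖ ^ 2 := by ring
      _ = _ := by rw [htd, one_mul]
  calc ‖D x‖ ^ 2 = d * (t * ‖D x‖ ^ 2) := by rw [← mul_assoc, htd, one_mul]
    _ ≤ _ := by
      gcongr
      linarith

/-- If a self-adjoint operator is nonnegative and bounded below on an invariant subspace, then it is
positive definite there. -/
theorem IsSelfAdjoint.exists_le_re_inner {D : E →L[𝕜] E} (hD : IsSelfAdjoint D)
    {M : Submodule 𝕜 E} (hM : ∀ x ∈ M, D x ∈ M) (hpos : ∀ x ∈ M, 0 ≤ RCLike.re (inner 𝕜 (D x) x))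
    {r : ℝ} (hr : 0 < r) (h : ∀ x ∈ M, r * ‖x‖ ≤ ‖D x‖) :
    ∃ c > 0, ∀ x ∈ M, c * ‖x‖ ^ 2 ≤ RCLike.re (inner 𝕜 (D x) x) := by
  have hd0 : 0 < ‖D‖ + 1 := by positivity
  refine ⟨(‖D‖ + 1)⁻¹ * r ^ 2, by positivity, fun x hx => ?_⟩
  rw [mul_assoc, inv_mul_le_iff₀ hd0, ← mul_pow]
  refine le_trans ?_ (hD.norm_map_sq_le hd0 (by linarith)
    (hpos _ (sub_mem hx (Submodule.smul_mem _ _ (hM x hx)))))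
  gcongr
  exact h x hx

namespace IsWindowAt

variable {T : E →L[𝕜] E} {ε : ℝ}

/-- On the orthogonal complement of the eigenspaces inside the window, `T` is bounded below by more
than `ε`. -/
theorem exists_le_norm_map (hT : IsSelfAdjoint T) (h : IsWindowAt T ε) :
    ∃ ρ > ε, ∀ x ∈ (eigenSpan T (-ε) ε)ᗮ, ρ * ‖x‖ ≤ ‖T x‖ := by
  set V := eigenSpan T (-ε) ε
  have hinv : ∀ x ∈ Vᗮ, T x ∈ Vᗮ := fun x hx =>
    hT.map_mem_orthogonal (fun _ => map_mem_eigenSpan) hx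
  have hshift : ∀ μ ∈ Set.Icc (-ε) ε, ∃ r > 0, ∀ x ∈ Vᗮ, r * ‖x‖ ≤ ‖shiftOp T μ x‖ :=
      fun μ hμ => by
    obtain ⟨r, hr, hle⟩ := (h.isFredholm μ hμ).exists_le_norm_map
    refine ⟨r, hr, fun x hx => hle x (Submodule.orthogonal_le ?_ hx)⟩
    rw [show (shiftOp T μ).ker = Module.End.eigenspace (T : E →ₗ[𝕜] E) ((-μ : ℝ) : 𝕜) by
      rw [eigenspace_eq_ker_shiftOp, neg_neg]]
    exact eigenspace_le_eigenSpan T ⟨by linarith [hμ.2], by linarith [hμ.1]⟩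
  -- Any lower bound `κ ≤ ε` can be improved. On the complement `T² - κ²` is nonnegative, and as the
  -- product of `T + κ` and `T - κ` it is bounded below, hence positive definite.
  have step : ∀ κ ∈ Set.Icc 0 ε, (∀ x ∈ Vᗮ, κ * ‖x‖ ≤ ‖T x‖) →
      ∃ κ' > κ, ∀ x ∈ Vᗮ, κ' * ‖x‖ ≤ ‖T x‖ := fun κ hκ hle => by
    obtain ⟨r₁, hr₁, h₁⟩ := hshift κ ⟨by linarith [hκ.1, h.pos], hκ.2⟩
    obtain ⟨r₂, hr₂, h₂⟩ := hshift (-κ) ⟨by linarith [hκ.2], by linarith [hκ.1, h.pos]⟩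
    set D : E →L[𝕜] E := shiftOp (T * T) (-κ ^ 2)
    have hDT : ∀ x, D x = shiftOp T κ (shiftOp T (-κ) x) := fun x => by
      simp only [D, shiftOp_apply, mul_apply_eq_comp, map_add, map_smul, smul_add,
        smul_smul]
      push_cast
      module
    have hDre : ∀ x, RCLike.re (inner 𝕜 (D x) x) = ‖T x‖ ^ 2 - κ ^ 2 * ‖x‖ ^ 2 := fun x => by
      have e1 : inner 𝕜 (T (T x)) x = inner 𝕜 (T x) (T x) := hT.inner_map_comm _ _
      change RCLike.re (inner 𝕜 (T (T x) + ((-κ ^ 2 : ℝ) : 𝕜) • x) x) = _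
      simp only [inner_add_left, inner_smul_left, e1, inner_self_eq_norm_sq_to_K,
        RCLike.conj_ofReal, ← RCLike.ofReal_pow, map_add, RCLike.re_ofReal_mul, RCLike.ofReal_re]
      ring
    have hDsa : IsSelfAdjoint D := by
      refine IsSelfAdjoint.shiftOp ?_ _
      exact hT.commute_iff hT |>.1 (Commute.refl T)
    have hsinv : ∀ μ : ℝ, ∀ x ∈ Vᗮ, shiftOp T μ x ∈ Vᗮ := fun μ x hx =>
      add_mem (hinv x hx) (Submodule.smul_mem _ _ hx)
    obtain ⟨c, hc, hcle⟩ := hDsa.exists_le_re_inner (M := Vᗮ)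
      (fun x hx => by rw [hDT]; exact hsinv _ _ (hsinv _ _ hx))
      (fun x hx => by
        rw [hDre, sub_nonneg, ← mul_pow]
        have := hle x hx
        have := hκ.1
        gcongr)
      (mul_pos hr₁ hr₂) (fun x hx => by
        rw [hDT, mul_assoc]
        exact (mul_le_mul_of_nonneg_left (h₂ x hx) hr₁.le).trans (h₁ _ (hsinv _ _ hx)))
    refine ⟨√(κ ^ 2 + c), Real.lt_sqrt_of_sq_lt (by linarith), fun x hx => ?_⟩
    refine le_of_sq_le_sq ?_ (norm_nonneg _)
    rw [mul_pow, Real.sq_sqrt (by positivity)]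
    have := hcle x hx
    rw [hDre] at this
    linarith
  -- The largest lower bound in `[0, ε]` is attained; its improvement must leave `[0, ε]`, hence
  -- exceeds `ε`.
  have hcomp : IsCompact {κ ∈ Set.Icc 0 ε | ∀ x ∈ Vᗮ, κ * ‖x‖ ≤ ‖T x‖} := by
    refine isCompact_Icc.inter_right ?_
    have : {κ : ℝ | ∀ x ∈ Vᗮ, κ * ‖x‖ ≤ ‖T x‖} = ⋂ x ∈ Vᗮ, {κ : ℝ | κ * ‖x‖ ≤ ‖T x‖} := by
      ext
      simp
    change IsClosed {κ : ℝ | ∀ x ∈ Vᗮ, κ * ‖x‖ ≤ ‖T x‖}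
    rw [this]
    exact isClosed_biInter fun x _ => isClosed_le (by fun_prop) continuous_const
  obtain ⟨κ, ⟨hκ, hle⟩, hmax⟩ := hcomp.exists_isGreatest
    ⟨0, ⟨le_rfl, h.pos.le⟩, fun x _ => by simp⟩
  obtain ⟨κ', hκ', hle'⟩ := step κ hκ hle
  refine ⟨κ', ?_, hle'⟩
  by_contra! hcon
  exact absurd (hmax ⟨⟨hκ.1.trans hκ'.le, hcon⟩, hle'⟩) (not_le.2 hκ')

theorem le_norm_map (hT : IsSelfAdjoint T) (h : IsWindowAt T ε) {x : E}
    (hx : x ∈ (eigenSpan T (-ε) ε)ᗮ) : ε * ‖x‖ ≤ ‖T x‖ := by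
  obtain ⟨ρ, hρ, hle⟩ := h.exists_le_norm_map hT
  exact (mul_le_mul_of_nonneg_right hρ.le (norm_nonneg _)).trans (hle x hx)

theorem norm_map_le (hT : IsSelfAdjoint T) (h : IsWindowAt T ε) {x : E}
    (hx : x ∈ eigenSpan T (-ε) ε) : ‖T x‖ ≤ ε * ‖x‖ := by
  obtain ⟨ρ, hρ, hle⟩ := h.exists_norm_map_le hT
  exact (hle x hx).trans (mul_le_mul_of_nonneg_right hρ.le (norm_nonneg _))

/-- A spectral window of a self-adjoint operator is a spectral window of all nearby operators. -/
theorem eventually (hT : IsSelfAdjoint T) (h : IsWindowAt T ε) :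
    ∀ᶠ S in 𝓝 T, IsWindowAt S ε := by
  have hu : ∀ μ, IsUnit (shiftOp T μ) → ∀ᶠ S in 𝓝 T, IsUnit (shiftOp S μ) := fun μ hμ =>
    (continuous_shiftOp.comp (Continuous.prodMk_left μ)).continuousAt.eventually
      (Units.isOpen.mem_nhds hμ)
  have hf := isCompact_Icc.eventually_forall_of_forall_eventually
    (P := fun (S : E →L[𝕜] E) μ => (shiftOp S μ).IsFredholm)
    fun μ hμ => isFredholm_shiftOp_eventually hT (h.isFredholm μ hμ)
  filter_upwards [hu _ h.isUnit_add, hu _ h.isUnit_sub, hf] with S h1 h2 h3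
  exact ⟨h.pos, h1, h2, h3⟩

/-- The number of eigenvalues inside a spectral window is locally constant. -/
theorem eventually_finrank_eq (hT : IsSelfAdjoint T) (h : IsWindowAt T ε) :
    ∀ᶠ S in 𝓝 T, IsSelfAdjoint S →
      Module.finrank 𝕜 (eigenSpan S (-ε) ε) = Module.finrank 𝕜 (eigenSpan T (-ε) ε) := by
  obtain ⟨ρ₁, hρ₁, h₁⟩ := h.exists_norm_map_le hT
  obtain ⟨ρ₂, hρ₂, h₂⟩ := h.exists_le_norm_map hT
  have hball : Metric.ball T (min (ε - ρ₁) (ρ₂ - ε)) ∈ 𝓝 T :=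
    Metric.ball_mem_nhds _ (lt_min (by linarith) (by linarith))
  filter_upwards [h.eventually hT, hball] with S hS hdist hSsa
  rw [mem_ball_iff_norm, lt_min_iff] at hdist
  have := h.finiteDimensional hT
  have := hS.finiteDimensional hSsa
  have hST : ∀ x, ‖S x - T x‖ ≤ ‖S - T‖ * ‖x‖ := fun x => (S - T).le_opNorm x
  -- A nonzero vector in one span and orthogonal to the other would be stretched by at most one side
  -- of the gap and at least the other, which `S - T` is too small to allow.
  refine le_antisymm (finrank_le_finrank_of_disjoint_orthogonal fun x hx hx' => ?_)
    (finrank_le_finrank_of_disjoint_orthogonal fun x hx hx' => ?_)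
  · by_contra h0
    have hx0 : 0 < ‖x‖ := norm_pos_iff.2 h0
    have e1 := h₂ x hx'
    have e2 := hS.norm_map_le hSsa hx
    have e3 := norm_sub_norm_le (T x) (S x)
    rw [norm_sub_rev] at e3
    nlinarith [hST x]
  · by_contra h0
    have hx0 : 0 < ‖x‖ := norm_pos_iff.2 h0
    have e1 := h₁ x hx
    have e2 := hS.le_norm_map hSsa hx'
    have e3 := norm_sub_norm_le (S x) (T x)
    nlinarith [hST x]

/-- The two spans are orthogonal: the only shared value is `ε'`, which is not an eigenvalue since it
is a window edge. -/
theorem eigenvalueCount_eq_add (hT : IsSelfAdjoint T) {ε' : ℝ} (h : IsWindowAt T ε)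
    (h' : IsWindowAt T ε') (hle : ε' ≤ ε) :
    eigenvalueCount T ε = eigenvalueCount T ε' + Module.finrank 𝕜 (eigenSpan T ε' ε) := by
  have := h.finiteDimensional_of_le hT (α := 0) (β := ε') (by linarith [h.pos]) hle
  have := h.finiteDimensional_of_le hT (α := ε') (β := ε) (by linarith [h.pos, h'.pos]) le_rfl
  have hdisj : eigenSpan T 0 ε' ⟂ eigenSpan T ε' ε := by
    refine Submodule.isOrtho_iSup_left.2 fun μ => Submodule.isOrtho_iSup_left.2 fun hμ =>
      Submodule.isOrtho_iSup_right.2 fun ν => Submodule.isOrtho_iSup_right.2 fun hν => ?_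
    rw [Submodule.isOrtho_iff_inner_eq]
    intro x hx y hy
    by_cases hne : μ = ν
    · have : μ = ε' := le_antisymm hμ.2 (hne ▸ hν.1)
      have hx0 : x = 0 := eq_zero_of_isUnit_shiftOp h'.isUnit_sub
        (this ▸ mem_eigenspace_iff_apply.1 hx)
      rw [hx0, inner_zero_left]
    · exact hT.isSymmetric.orthogonalFamily_eigenspaces
        (fun hc => hne (RCLike.ofReal_injective hc)) ⟨x, hx⟩ ⟨y, hy⟩
  rw [eigenvalueCount_eq, eigenvalueCount_eq, eigenSpan_sup T h'.pos.le hle,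
    ← Submodule.finrank_sup_add_finrank_inf_eq, hdisj.disjoint.eq_bot, finrank_bot, add_zero]

/-- The two counts differ by the number of eigenvalues in `[ε', ε]`. This interval is a window of
the operator shifted by its midpoint `m`, so that number is locally constant. -/
theorem eventually_eigenvalueCount_sub_of_le (hT : IsSelfAdjoint T) {ε' : ℝ} (h : IsWindowAt T ε)
    (h' : IsWindowAt T ε') (hle : ε' ≤ ε) :
    ∀ᶠ S in 𝓝 T, IsSelfAdjoint S →
      (eigenvalueCount S ε : ℤ) - eigenvalueCount T ε =
        eigenvalueCount S ε' - eigenvalueCount T ε' := by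
  rcases hle.eq_or_lt with rfl | hlt
  · exact Eventually.of_forall fun _ _ => rfl
  set m := (ε' + ε) / 2 with hm
  have hw : IsWindowAt (shiftOp T (-m)) ((ε - ε') / 2) := by
    refine ⟨by linarith, ?_, ?_, fun μ hμ => ?_⟩
    · rw [shiftOp_shiftOp, show -m + (ε - ε') / 2 = -ε' by rw [hm]; ring]
      exact h'.isUnit_sub
    · rw [shiftOp_shiftOp, show -m + -((ε - ε') / 2) = -ε by rw [hm]; ring]
      exact h.isUnit_sub
    · rw [shiftOp_shiftOp]
      exact h.isFredholm _ ⟨by linarith [hμ.1], by linarith [hμ.2, h.pos, h'.pos]⟩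
  have hcont : Continuous fun S : E →L[𝕜] E => shiftOp S (-m) :=
    continuous_shiftOp.comp (Continuous.prodMk_left _)
  filter_upwards [h.eventually hT, h'.eventually hT,
    hcont.continuousAt.eventually (hw.eventually_finrank_eq (hT.shiftOp _))] with S hS hS' hr hSsa
  have := hr (hSsa.shiftOp _)
  rw [eigenSpan_shiftOp, eigenSpan_shiftOp,
    show -((ε - ε') / 2) - -m = ε' by rw [hm]; ring,
    show (ε - ε') / 2 - -m = ε by rw [hm]; ring] at this
  rw [hS.eigenvalueCount_eq_add hSsa hS' hle, h.eigenvalueCount_eq_add hT h' hle, this]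
  push_cast
  ring

/-- The local change of the number of eigenvalues does not depend on the spectral window. -/
theorem eventually_eigenvalueCount_sub (hT : IsSelfAdjoint T) {ε' : ℝ} (h : IsWindowAt T ε)
    (h' : IsWindowAt T ε') :
    ∀ᶠ S in 𝓝 T, IsSelfAdjoint S →
      (eigenvalueCount S ε : ℤ) - eigenvalueCount T ε =
        eigenvalueCount S ε' - eigenvalueCount T ε' := by
  rcases le_total ε' ε with hle | hle
  · exact h.eventually_eigenvalueCount_sub_of_le hT h' hle
  · filter_upwards [h'.eventually_eigenvalueCount_sub_of_le hT h hle] with S hS hSsa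
    exact (hS hSsa).symm

theorem eventually_eigenvalueCount_eq_zero (hT : IsSelfAdjoint T) (h : IsWindowAt T ε)
    (h0 : eigenSpan T (-ε) ε = ⊥) :
    ∀ᶠ S in 𝓝 T, IsSelfAdjoint S → eigenvalueCount S ε = 0 := by
  filter_upwards [h.eventually hT, h.eventually_finrank_eq hT] with S hS hr hSsa
  have hr := hr hSsa
  have := hS.finiteDimensional hSsa
  rw [h0, finrank_bot, Submodule.finrank_eq_zero] at hr
  rw [eigenvalueCount_eq, eq_bot_mono (eigenSpan_mono S (by linarith [h.pos]) le_rfl) hr,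
    finrank_bot]

/-- Let `0` be the only eigenvalue of `T` in the window. If `S ≤ T` is close to `T`, then the
eigenvectors of `S` whose eigenvalue lies in `[0, ε]` are in the kernel of `T` and of `S`. -/
theorem eventually_mem_ker (hT : IsSelfAdjoint T) (h : IsWindowAt T ε)
    (hker : eigenSpan T (-ε) ε ≤ T.ker) :
    ∀ᶠ S in 𝓝 T, S ≤ T → ∀ μ ∈ Set.Icc 0 ε, ∀ x, S x = (μ : 𝕜) • x → T x = 0 ∧ S x = 0 := by
  obtain ⟨ρ, hρ, hle⟩ := h.exists_le_norm_map hT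
  have := h.finiteDimensional hT
  have hball : Metric.ball T (ρ - ε) ∈ 𝓝 T := Metric.ball_mem_nhds _ (by linarith)
  filter_upwards [hball] with S hS hST μ hμ x hx
  rw [mem_ball_iff_norm, norm_sub_rev] at hS
  set D := T - S with hD
  have hpos : D.IsPositive := hST
  obtain ⟨k, hk, w, hw, rfl⟩ := (eigenSpan T (-ε) ε).exists_add_mem_mem_orthogonal x
  set v := k + w with hv
  have hTk : T k = 0 := hker hk
  have hTv : T v = (μ : 𝕜) • v + D v := by rw [hD, sub_apply, ← hx]; abel
  have hTw : T v = T w := by rw [hv, map_add, hTk, zero_add]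
  have hwk : inner 𝕜 w k = 0 := Submodule.inner_left_of_mem_orthogonal hk hw
  -- The component of `D v` in the complement is `T w - μ w`, where `T` is bounded below by `ρ` and
  -- `μ ≤ ε`.
  have hwD : (ρ - ε) * ‖w‖ ≤ ‖D v‖ := by
    have hz : T w - (μ : 𝕜) • w ∈ (eigenSpan T (-ε) ε)ᗮ := sub_mem
      (hT.map_mem_orthogonal (fun _ => map_mem_eigenSpan) hw) (Submodule.smul_mem _ _ hw)
    have hDv : D v = -((μ : 𝕜) • k) + (T w - (μ : 𝕜) • w) := by
      rw [← hTw, hTv, hv, smul_add]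
      abel
    have h1 : ‖T w - (μ : 𝕜) • w‖ ≤ ‖D v‖ := by
      refine le_of_sq_le_sq ?_ (norm_nonneg _)
      rw [hDv, norm_sq_add_of_mem_orthogonal (neg_mem (Submodule.smul_mem _ _ hk)) hz]
      exact le_add_of_nonneg_left (sq_nonneg _)
    have h2 := norm_sub_norm_le (T w) ((μ : 𝕜) • w)
    rw [norm_smul, RCLike.norm_ofReal, abs_of_nonneg hμ.1] at h2
    have h3 := mul_le_mul_of_nonneg_right hμ.2 (norm_nonneg w)
    linarith [hle w hw]
  set q := RCLike.re (inner 𝕜 (D v) v)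
  have hq0 : 0 ≤ q := hpos.re_inner_nonneg_left v
  -- With `‖D‖ < d < ρ - ε`, the chain `(ρ - ε) * q ≤ ‖D v‖ ^ 2 ≤ d * q` will force `q = 0`.
  obtain ⟨d, hd, hdρ⟩ := exists_between hS
  have hd0 : 0 < d := (norm_nonneg _).trans_lt hd
  have hDq : ‖D v‖ ^ 2 ≤ d * q :=
    hpos.isSelfAdjoint.norm_map_sq_le hd0 hd.le (hpos.re_inner_nonneg_left _)
  -- This is `T v = μ v + D v` paired with `k`, which `T` kills.
  have hk2 : μ * ‖k‖ ^ 2 = - q + RCLike.re (inner 𝕜 (D v) w) := by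
    have e1 : inner 𝕜 (T v) k = 0 := by rw [hT.inner_map_comm, hTk, inner_zero_right]
    rw [hTv, inner_add_left, inner_smul_left, RCLike.conj_ofReal] at e1
    have e2 : inner 𝕜 v k = ((‖k‖ ^ 2 : ℝ) : 𝕜) := by
      rw [hv, inner_add_left, hwk, add_zero, inner_self_eq_norm_sq_to_K]
      push_cast
      rfl
    have e3 : q = RCLike.re (inner 𝕜 (D v) k) + RCLike.re (inner 𝕜 (D v) w) := by
      rw [← map_add, ← inner_add_right]
    have e4 := congrArg RCLike.re e1
    rw [e2, ← RCLike.ofReal_mul, map_add, RCLike.ofReal_re, map_zero] at e4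
    linarith
  have hqle : q ≤ ‖D v‖ * ‖w‖ := by
    have := mul_nonneg hμ.1 (sq_nonneg ‖k‖)
    linarith [re_inner_le_norm (𝕜 := 𝕜) (D v) w]
  have hq : q = 0 := by
    have h1 : (ρ - ε) * q ≤ ‖D v‖ ^ 2 := by
      nlinarith [mul_le_mul_of_nonneg_left hwD (norm_nonneg (D v))]
    nlinarith
  have hDv : D v = 0 := by
    rw [← norm_eq_zero, ← sq_eq_zero_iff]
    refine le_antisymm ?_ (sq_nonneg _)
    rwa [hq, mul_zero] at hDq
  have hw0 : w = 0 := by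
    rw [hDv, norm_zero] at hwD
    rw [← norm_eq_zero]
    nlinarith [norm_nonneg w]
  have hTv0 : T v = 0 := by rw [hTw, hw0, map_zero]
  refine ⟨hTv0, ?_⟩
  rwa [hD, sub_apply, hTv0, zero_sub, neg_eq_zero] at hDv

omit [CompleteSpace E] in
theorem eigenvalueCount_eq_finrank (h : IsWindowAt T ε) (hker : eigenSpan T (-ε) ε ≤ T.ker) :
    eigenvalueCount T ε = Module.finrank 𝕜 (eigenSpan T (-ε) ε) := by
  rw [eigenvalueCount_eq, le_antisymm (eigenSpan_mono T (neg_nonpos.2 h.pos.le) le_rfl)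
    fun x hx => mem_eigenSpan (μ := 0) ⟨le_rfl, h.pos.le⟩ (by simpa using hker hx)]

theorem eventually_eigenvalueCount_le (hT : IsSelfAdjoint T) (h : IsWindowAt T ε)
    (hker : eigenSpan T (-ε) ε ≤ T.ker) :
    ∀ᶠ S in 𝓝 T, S ≤ T → eigenvalueCount S ε ≤ eigenvalueCount T ε := by
  have := h.finiteDimensional_of_le hT (α := 0) (β := ε) (by linarith [h.pos]) le_rfl
  filter_upwards [h.eventually_mem_ker hT hker] with S hS hST
  refine Submodule.finrank_mono (t := eigenSpan _ 0 ε) (eigenSpan_le_iff.2 fun μ hμ x hx => ?_)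
  exact mem_eigenSpan (μ := 0) ⟨le_rfl, h.pos.le⟩ (by simpa using (hS hST μ hμ x hx).1)

omit [CompleteSpace E] in
theorem neg (h : IsWindowAt T ε) : IsWindowAt (-T) ε := by
  have key : ∀ μ, shiftOp (-T) μ = -shiftOp T (-μ) := fun μ => by
    ext x
    simp [shiftOp_apply]
    abel
  refine ⟨h.pos, ?_, ?_, fun μ hμ => ?_⟩
  · rw [key]
    exact h.isUnit_sub.neg
  · rw [key, neg_neg]
    exact h.isUnit_add.neg
  · rw [key]
    exact (h.isFredholm _ ⟨by linarith [hμ.2], by linarith [hμ.1]⟩).neg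

/-- By `eventually_mem_ker` for `-T`, a growing perturbation pushes no eigenvalue below zero:
eigenvectors of `S` with eigenvalue in `[-ε, 0]` lie in its kernel. So the whole window span is
counted, and its dimension is locally constant. -/
theorem eventually_le_eigenvalueCount (hT : IsSelfAdjoint T) (h : IsWindowAt T ε)
    (hker : eigenSpan T (-ε) ε ≤ T.ker) :
    ∀ᶠ S in 𝓝 T, IsSelfAdjoint S → T ≤ S → eigenvalueCount T ε ≤ eigenvalueCount S ε := by
  have hker' : eigenSpan (-T) (-ε) ε ≤ (-T).ker := eigenSpan_le_iff.2 fun μ hμ x hx => by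
    have : T x = ((-μ : ℝ) : 𝕜) • x := by
      rw [← neg_neg (T x), ← neg_apply, hx]
      simp
    have h0 : T x = 0 := hker (mem_eigenSpan ⟨by linarith [hμ.2], by linarith [hμ.1]⟩ this)
    simp [h0]
  have hneg := continuous_neg.continuousAt.eventually (h.neg.eventually_mem_ker hT.neg hker')
  filter_upwards [hneg, h.eventually hT, h.eventually_finrank_eq hT] with S hS hw hr hSsa hTS
  have := hw.finiteDimensional_of_le hSsa (α := 0) (β := ε) (by linarith [h.pos]) le_rfl
  rw [h.eigenvalueCount_eq_finrank hker, ← hr hSsa]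
  refine Submodule.finrank_mono (t := eigenSpan _ 0 ε) (eigenSpan_le_iff.2 fun μ hμ x hx => ?_)
  rcases le_total 0 μ with h0 | h0
  · exact mem_eigenSpan ⟨h0, hμ.2⟩ hx
  · have hTS' : -S ≤ -T := (ContinuousLinearMap.le_def _ _).2 (by rwa [neg_sub_neg])
    have hSx := (hS hTS' (-μ) ⟨by linarith, by linarith [hμ.1]⟩ x (by
      rw [neg_apply, hx]
      simp)).2
    rw [neg_apply, neg_eq_zero] at hSx
    exact mem_eigenSpan (μ := 0) ⟨le_rfl, h.pos.le⟩ (by simpa using hSx)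

end IsWindowAt

end SpectralWindow

/-! ### From local to global on an interval, and telescoping sums. -/

theorem eq_of_eventually_eq_Icc {α : Type*} {a b : ℝ} {f : ℝ → α}
    (h : ∀ x ∈ Set.Icc a b, ∀ᶠ y in 𝓝[Set.Icc a b] x, f y = f x) {x y : ℝ}
    (hx : x ∈ Set.Icc a b) (hy : y ∈ Set.Icc a b) : f x = f y := by
  let _ : TopologicalSpace α := ⊥
  have : DiscreteTopology α := ⟨rfl⟩
  refine isPreconnected_Icc.constant (fun z hz => ?_) hx hy
  exact tendsto_const_nhds.congr' ((h z hz).mono fun _ hw => hw.symm)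

/-- Real induction on the points up to which `f` stays at least `f a`. The comparison to the left of
a point shows that this set is closed, the one to the right that it can be extended. Values are only
compared with the one at the centre, so `f` is not assumed locally monotone. -/
theorem le_of_eventually_le_Icc {a b : ℝ} (hab : a ≤ b) {f : ℝ → ℤ}
    (h : ∀ x ∈ Set.Icc a b, ∀ᶠ y in 𝓝[Set.Icc a b] x,
      (x ≤ y → f x ≤ f y) ∧ (y ≤ x → f y ≤ f x)) : f a ≤ f b := by
  set S : Set ℝ := {x | ∀ y ∈ Set.Icc a x, f a ≤ f y} with hS
  have hclosed : IsClosed (S ∩ Set.Icc a b) := by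
    refine isClosed_of_closure_subset fun x hx => ?_
    have hxI : x ∈ Set.Icc a b :=
      closure_minimal Set.inter_subset_right isClosed_Icc hx
    refine ⟨fun y hy => ?_, hxI⟩
    have hlt : ∀ z ∈ Set.Ico a x, f a ≤ f z := fun z hz => by
      obtain ⟨w, hzw, hw⟩ := mem_closure_iff.1 hx (Set.Ioi z) isOpen_Ioi hz.2
      exact hw.1 z ⟨hz.1, (Set.mem_Ioi.1 hzw).le⟩
    rcases hy.2.lt_or_eq with hyx | rfl
    · exact hlt y ⟨hy.1, hyx⟩
    · rcases hy.1.eq_or_lt with rfl | hay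
      · exact le_rfl
      · have h1 : ∀ᶠ z in 𝓝[<] y, z ∈ Set.Ioo a y := Ioo_mem_nhdsLT hay
        have h2 : 𝓝[Set.Ioo a y] y ≤ 𝓝[Set.Icc a b] y :=
          nhdsWithin_mono _ fun z hz => ⟨hz.1.le, hz.2.le.trans hxI.2⟩
        rw [nhdsWithin_Ioo_eq_nhdsLT hay] at h2
        obtain ⟨z, hz, hzI⟩ := (((h y hxI).filter_mono h2).and h1).exists
        exact (hlt z ⟨hzI.1.le, hzI.2⟩).trans (hz.2 hzI.2.le)
  have hsub := hclosed.Icc_subset_of_forall_mem_nhdsWithin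
    (fun y hy => le_of_eq (by rw [le_antisymm hy.2 hy.1])) fun x hx => by
      have hxI : x ∈ Set.Icc a b := ⟨hx.2.1, hx.2.2.le⟩
      have h2 : 𝓝[Set.Ico x b] x ≤ 𝓝[Set.Icc a b] x :=
        nhdsWithin_mono _ fun z hz => ⟨hx.2.1.trans hz.1, hz.2.le⟩
      rw [nhdsWithin_Ico_eq_nhdsGE hx.2.2] at h2
      obtain ⟨u, hu, hsub⟩ := (mem_nhdsGE_iff_exists_Ico_subset' hx.2.2).1
        ((h x hxI).filter_mono h2)
      refine mem_of_superset (Ioo_mem_nhdsGT hu) fun z hz y hy => ?_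
      rcases le_total y x with hyx | hxy
      · exact hx.1 y ⟨hy.1, hyx⟩
      · exact (hx.1 x ⟨hx.2.1, le_rfl⟩).trans ((hsub ⟨hxy, hy.2.trans_lt hz.2⟩).1 hxy)
  exact hsub (Set.right_mem_Icc.2 hab) b (Set.right_mem_Icc.2 hab)

theorem le_of_forall_le_succ {t : ℕ → ℝ} {N : ℕ} (ht : ∀ i < N, t i ≤ t (i + 1)) {i j : ℕ}
    (hij : i ≤ j) (hj : j ≤ N) : t i ≤ t j := by
  induction j, hij using Nat.le_induction with
  | base => exact le_rfl
  | succ k _ ih => exact (ih (by omega)).trans (ht k (by omega))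

theorem sum_sub_clamp {t : ℕ → ℝ} {N : ℕ} (ht : ∀ i < N, t i ≤ t (i + 1)) (g : ℝ → ℤ) (y : ℝ) :
    ∑ i ∈ Finset.range N, (g (max (t i) (min y (t (i + 1)))) - g (t i)) =
      g (max (t 0) (min y (t N))) - g (t 0) := by
  induction N with
  | zero => simp
  | succ N ih =>
    have h0 : t 0 ≤ t N :=
      le_of_forall_le_succ (fun i hi => ht i (hi.trans N.lt_succ_self)) N.zero_le le_rfl
    have h1 := ht N N.lt_succ_self
    rw [Finset.sum_range_succ, ih fun i hi => ht i (hi.trans N.lt_succ_self)]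
    rcases le_total y (t N) with hy | hy
    · rw [min_eq_left hy, min_eq_left (hy.trans h1), max_eq_left hy]
      ring
    · rw [min_eq_right hy, max_eq_right h0, max_eq_right (le_min hy h1),
        max_eq_right (h0.trans (le_min hy h1))]
      ring

/-! ### Spectral potentials of a path. -/

section SpectralFlow

variable {𝕜 E : Type*} [RCLike 𝕜] [NormedAddCommGroup E] [InnerProductSpace 𝕜 E]

/-- `F` is a spectral potential of the path `L` on `[a, b]`: locally, its increments count the
change of the number of eigenvalues in `[0, ε]` for any spectral window `ε`. -/
def IsSpectralPotential (L : ℝ → E →L[𝕜] E) (a b : ℝ) (F : ℝ → ℤ) : Prop :=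
  ∀ x ∈ Set.Icc a b, ∀ ε, IsWindowAt (L x) ε → ∀ᶠ y in 𝓝[Set.Icc a b] x,
    F y - F x = eigenvalueCount (L y) ε - eigenvalueCount (L x) ε

theorem isSpectralWindow_iff {L : ℝ → E →L[𝕜] E} {c d ε : ℝ} (hcd : c ≤ d) :
    IsSpectralWindow L c d ε ↔ ∀ s ∈ Set.Icc c d, IsWindowAt (L s) ε :=
  ⟨fun h s hs => ⟨h.1, (h.2 s hs).1, (h.2 s hs).2.1, (h.2 s hs).2.2⟩,
    fun h => ⟨(h c ⟨le_rfl, hcd⟩).pos, fun s hs =>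
      ⟨(h s hs).isUnit_add, (h s hs).isUnit_sub, (h s hs).isFredholm⟩⟩⟩

variable [CompleteSpace E]

theorem exists_isWindowAt_of_mem {T : E →L[𝕜] E} (hT : T ∈ fredholmSelfAdjoint 𝕜 E) :
    ∃ ε, IsWindowAt T ε :=
  (hT.2.exists_isWindowAt hT.1).imp fun _ h => h.1

theorem shiftOp_mem_fredholmSelfAdjoint {T : E →L[𝕜] E} (hT : IsSelfAdjoint T) {μ : ℝ}
    (h : (shiftOp T μ).IsFredholm) : shiftOp T μ ∈ fredholmSelfAdjoint 𝕜 E :=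
  ⟨hT.shiftOp μ, h⟩

section Path

variable {L : ℝ → E →L[𝕜] E} {a b : ℝ}

theorem eventually_of_continuousOn {X : Type*} [TopologicalSpace X] {A : X → E →L[𝕜] E}
    {K : Set X} (hA : ContinuousOn A K)
    (hΦ : ∀ p ∈ K, A p ∈ fredholmSelfAdjoint 𝕜 E) {x : X} (hx : x ∈ K)
    {P : (E →L[𝕜] E) → Prop} (h : ∀ᶠ S in 𝓝 (A x), IsSelfAdjoint S → P S) :
    ∀ᶠ y in 𝓝[K] x, P (A y) := by
  filter_upwards [(hA x hx).eventually h, self_mem_nhdsWithin] with y hy hyK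
  exact hy (hΦ y hyK).1

/-- A window at one operator works nearby, so windows give an open cover of `[a, b]`, and a fine
enough subdivision fits into it. -/
theorem exists_hasSpectralFlow (hab : a ≤ b) (hL : ContinuousOn L (Set.Icc a b))
    (hΦ : ∀ s ∈ Set.Icc a b, L s ∈ fredholmSelfAdjoint 𝕜 E) : ∃ n, HasSpectralFlow L a b n := by
  choose ε hε using fun s : Set.Icc a b => exists_isWindowAt_of_mem (hΦ s s.2)
  have hcov : Set.univ ⊆ ⋃ s, interior {y : Set.Icc a b | IsWindowAt (L y) (ε s)} := fun s _ => by
    refine Set.mem_iUnion.2 ⟨s, mem_interior_iff_mem_nhds.2 ?_⟩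
    exact (continuousOn_iff_continuous_domRestrict.1 hL).continuousAt.eventually
      ((hε s).eventually (hΦ s s.2).1)
  obtain ⟨t, h0, hmono, ⟨N, hN⟩, hsub⟩ :=
    exists_monotone_Icc_subset_open_cover_Icc hab (fun _ => isOpen_interior) hcov
  choose i hi using hsub
  refine ⟨_, N, fun j => t j, fun j => ε (i j), h0, hN N le_rfl, fun j _ =>
    ⟨hmono j.le_succ, (isSpectralWindow_iff (hmono j.le_succ)).2 fun s hs => ?_⟩, rfl⟩
  let s' : Set.Icc a b := ⟨s, (t j).2.1.trans hs.1, hs.2.trans (t (j + 1)).2.2⟩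
  have hs' : s' ∈ Set.Icc (t j) (t (j + 1)) := hs
  exact interior_subset (s := {y : Set.Icc a b | IsWindowAt (L y) (ε (i j))}) (hi j hs')

/-- The potential adds up, over the pieces of a subdivision, the counts at `y` clamped to each
piece. Near `x` only pieces containing `x` vary, each fixed window may be replaced there by the
given `η`, and the sum telescopes. -/
theorem exists_isSpectralPotential (hab : a ≤ b) (hL : ContinuousOn L (Set.Icc a b))
    (hΦ : ∀ s ∈ Set.Icc a b, L s ∈ fredholmSelfAdjoint 𝕜 E) :
    ∃ F, IsSpectralPotential L a b F := by
  obtain ⟨-, N, t, ε, rfl, rfl, ht, -⟩ := exists_hasSpectralFlow hab hL hΦ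
  set p : ℕ → ℝ → ℝ := fun i y => max (t i) (min y (t (i + 1))) with hp
  have hpI : ∀ i < N, ∀ y, p i y ∈ Set.Icc (t i) (t (i + 1)) := fun i hi y =>
    ⟨le_max_left _ _, max_le (ht i hi).1 (min_le_right _ _)⟩
  have htI : ∀ i < N, Set.Icc (t i) (t (i + 1)) ⊆ Set.Icc (t 0) (t N) := fun i hi =>
    Set.Icc_subset_Icc (le_of_forall_le_succ (fun j hj => (ht j hj).1) i.zero_le hi.le)
      (le_of_forall_le_succ (fun j hj => (ht j hj).1) (by omega) le_rfl)
  have hpc : ∀ i, Continuous (p i) := fun i => by fun_prop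
  refine ⟨fun y => ∑ i ∈ Finset.range N, (eigenvalueCount (L (p i y)) (ε i) : ℤ),
    fun x hx η hη => ?_⟩
  have key : ∀ i ∈ Finset.range N, ∀ᶠ y in 𝓝[Set.Icc (t 0) (t N)] x,
      (eigenvalueCount (L (p i y)) (ε i) : ℤ) - eigenvalueCount (L (p i x)) (ε i) =
        eigenvalueCount (L (p i y)) η - eigenvalueCount (L (p i x)) η := fun i hi => by
    rw [Finset.mem_range] at hi
    by_cases hxi : x ∈ Set.Icc (t i) (t (i + 1))
    · have hpx : p i x = x := by
        simp only [hp]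
        rw [min_eq_left hxi.2, max_eq_right hxi.1]
      have h1 := eventually_of_continuousOn hL hΦ hx
        ((((isSpectralWindow_iff (ht i hi).1).1 (ht i hi).2 x hxi).eventually_eigenvalueCount_sub
          (hΦ x hx).1 hη))
      have h2 : Tendsto (p i) (𝓝[Set.Icc (t 0) (t N)] x) (𝓝[Set.Icc (t 0) (t N)] x) := by
        refine tendsto_nhdsWithin_of_tendsto_nhds_of_eventually_within _ ?_
          (Eventually.of_forall fun y => htI i hi (hpI i hi y))
        have := (hpc i).tendsto x
        rw [hpx] at this
        exact this.mono_left nhdsWithin_le_nhds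
      rw [hpx]
      exact h2.eventually h1
    · have h1 : ∀ᶠ y in 𝓝 x, p i y = p i x := by
        rw [Set.mem_Icc, not_and_or, not_le, not_le] at hxi
        rcases hxi with hxi | hxi
        · filter_upwards [Iio_mem_nhds hxi] with y hy
          simp only [hp]
          rw [max_eq_left ((min_le_left _ _).trans (le_of_lt hy)),
            max_eq_left ((min_le_left _ _).trans hxi.le)]
        · filter_upwards [Ioi_mem_nhds hxi] with y hy
          simp only [hp]
          rw [min_eq_right (le_of_lt hy), min_eq_right hxi.le]
      filter_upwards [h1.filter_mono nhdsWithin_le_nhds] with y hy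
      rw [hy, sub_self, sub_self]
  filter_upwards [(Finset.eventually_all _).2 key, self_mem_nhdsWithin] with y hy hyI
  have hs := fun z (hz : z ∈ Set.Icc (t 0) (t N)) =>
    sum_sub_clamp (fun j hj => (ht j hj).1) (fun z => (eigenvalueCount (L z) η : ℤ)) z
  have hcl : ∀ z ∈ Set.Icc (t 0) (t N), max (t 0) (min z (t N)) = z := fun z hz => by
    rw [min_eq_left hz.2, max_eq_right hz.1]
  have e1 := hs y hyI
  have e2 := hs x hx
  rw [hcl y hyI, Finset.sum_sub_distrib] at e1
  rw [hcl x hx, Finset.sum_sub_distrib] at e2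
  rw [← Finset.sum_sub_distrib, Finset.sum_congr rfl hy, Finset.sum_sub_distrib]
  linarith

-- On each piece `F` minus the count in the window of that piece is locally constant, hence
-- constant; the increments of `F` telescope.
omit [CompleteSpace E] in
theorem IsSpectralPotential.eq_sub {F : ℝ → ℤ} (hF : IsSpectralPotential L a b F) {n : ℤ}
    (h : HasSpectralFlow L a b n) : n = F b - F a := by
  obtain ⟨N, t, ε, rfl, rfl, ht, rfl⟩ := h
  rw [← Finset.sum_range_sub (fun i => F (t i))]
  · refine Finset.sum_congr rfl fun i hi => ?_
    rw [Finset.mem_range] at hi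
    have hle := (ht i hi).1
    have hsub : Set.Icc (t i) (t (i + 1)) ⊆ Set.Icc (t 0) (t N) :=
      Set.Icc_subset_Icc (le_of_forall_le_succ (fun j hj => (ht j hj).1) i.zero_le hi.le)
        (le_of_forall_le_succ (fun j hj => (ht j hj).1) (by omega) le_rfl)
    have := eq_of_eventually_eq_Icc (a := t i) (b := t (i + 1))
      (f := fun s => F s - eigenvalueCount (L s) (ε i)) (fun x hx => by
        filter_upwards [nhdsWithin_mono _ hsub (hF x (hsub hx) (ε i)
          ((isSpectralWindow_iff hle).1 (ht i hi).2 x hx))] with y hy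
        have hy : F y - F x = _ := hy
        linarith) (Set.left_mem_Icc.2 hle) (Set.right_mem_Icc.2 hle)
    linarith

theorem HasSpectralFlow.unique (hab : a ≤ b) (hL : ContinuousOn L (Set.Icc a b))
    (hΦ : ∀ s ∈ Set.Icc a b, L s ∈ fredholmSelfAdjoint 𝕜 E) {m n : ℤ}
    (hm : HasSpectralFlow L a b m) (hn : HasSpectralFlow L a b n) : m = n := by
  obtain ⟨F, hF⟩ := exists_isSpectralPotential hab hL hΦ
  rw [hF.eq_sub hm, hF.eq_sub hn]

/-- Near an invertible operator a small window contains no eigenvalues, so the potential is locally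
constant. -/
theorem IsSpectralPotential.eq_of_isUnit {F : ℝ → ℤ} (hF : IsSpectralPotential L a b F)
    (hL : ContinuousOn L (Set.Icc a b))
    (hΦ : ∀ s ∈ Set.Icc a b, L s ∈ fredholmSelfAdjoint 𝕜 E)
    (hu : ∀ s ∈ Set.Icc a b, IsUnit (L s)) (hab : a ≤ b) : F a = F b := by
  refine eq_of_eventually_eq_Icc (fun x hx => ?_) (Set.left_mem_Icc.2 hab)
    (Set.right_mem_Icc.2 hab)
  obtain ⟨ε, hε, hker⟩ := (hΦ x hx).2.exists_isWindowAt (hΦ x hx).1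
  have h0 : eigenSpan (L x) (-ε) ε = ⊥ := by
    refine eq_bot_iff.2 fun v hv => ?_
    refine (Submodule.mem_bot 𝕜).2 (eq_zero_of_isUnit_shiftOp (T := L x) (μ := 0) ?_ ?_)
    · rw [neg_zero, shiftOp_zero]
      exact hu x hx
    · simpa using hker hv
  have h1 := hε.eventually_eigenvalueCount_eq_zero (hΦ x hx).1 h0
  filter_upwards [hF x hx ε hε, eventually_of_continuousOn hL hΦ hx h1] with y hy h2
  rw [h2, h1.self_of_nhds (hΦ x hx).1, sub_self] at hy
  exact sub_eq_zero.1 hy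

/-- A spectral potential locally grows with the operators. -/
theorem IsSpectralPotential.eventually_le {F : ℝ → ℤ} (hF : IsSpectralPotential L a b F)
    (hL : ContinuousOn L (Set.Icc a b))
    (hΦ : ∀ s ∈ Set.Icc a b, L s ∈ fredholmSelfAdjoint 𝕜 E) {x : ℝ} (hx : x ∈ Set.Icc a b) :
    ∀ᶠ y in 𝓝[Set.Icc a b] x, (L x ≤ L y → F x ≤ F y) ∧ (L y ≤ L x → F y ≤ F x) := by
  obtain ⟨ε, hε, hker⟩ := (hΦ x hx).2.exists_isWindowAt (hΦ x hx).1
  have h1 := hε.eventually_eigenvalueCount_le (hΦ x hx).1 hker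
  have h2 := hε.eventually_le_eigenvalueCount (hΦ x hx).1 hker
  filter_upwards [hF x hx ε hε, (hL x hx).eventually h1,
    eventually_of_continuousOn hL hΦ hx h2] with y hy h1 h2
  refine ⟨fun h => ?_, fun h => ?_⟩
  · have := h2 h
    omega
  · have := h1 h
    omega

theorem IsSpectralPotential.le_of_monotoneOn {F : ℝ → ℤ} (hF : IsSpectralPotential L a b F)
    (hL : ContinuousOn L (Set.Icc a b))
    (hΦ : ∀ s ∈ Set.Icc a b, L s ∈ fredholmSelfAdjoint 𝕜 E) (hab : a ≤ b)
    (hmono : MonotoneOn L (Set.Icc a b)) : F a ≤ F b := by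
  refine le_of_eventually_le_Icc hab fun x hx => ?_
  filter_upwards [hF.eventually_le hL hΦ hx, self_mem_nhdsWithin] with y hy hyI
  exact ⟨fun h => hy.1 (hmono hx hyI h), fun h => hy.2 (hmono hyI hx h)⟩

theorem IsSpectralPotential.le_of_antitoneOn {F : ℝ → ℤ} (hF : IsSpectralPotential L a b F)
    (hL : ContinuousOn L (Set.Icc a b))
    (hΦ : ∀ s ∈ Set.Icc a b, L s ∈ fredholmSelfAdjoint 𝕜 E) (hab : a ≤ b)
    (hanti : AntitoneOn L (Set.Icc a b)) : F b ≤ F a := by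
  refine neg_le_neg_iff.1 (le_of_eventually_le_Icc (f := fun x => -F x) hab fun x hx => ?_)
  filter_upwards [hF.eventually_le hL hΦ hx, self_mem_nhdsWithin] with y hy hyI
  exact ⟨fun h => neg_le_neg (hy.2 (hanti hx hyI h)),
    fun h => neg_le_neg (hy.1 (hanti hyI hx h))⟩

end Path

end SpectralFlow

/-! ### Homotopy invariance, the extended flow and the comparison. -/

section SpectralFlow

variable {𝕜 E : Type*} [RCLike 𝕜] [NormedAddCommGroup E] [InnerProductSpace 𝕜 E] [CompleteSpace E]

omit [CompleteSpace E] in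
theorem ContinuousOn.shiftOp {X : Type*} [TopologicalSpace X] {A : X → E →L[𝕜] E} {f : X → ℝ}
    {K : Set X} (hA : ContinuousOn A K) (hf : ContinuousOn f K) :
    ContinuousOn (fun x => shiftOp (A x) (f x)) K :=
  continuous_shiftOp.comp_continuousOn (hA.prodMk hf)

/-- Homotopy invariance of the spectral flow: the difference of the spectral flows along two opposite
sides of a rectangle is the difference of the increments of the potentials along the other two. -/
theorem HasSpectralFlow.sub_eq_of_homotopy {a b c d : ℝ} (hab : a ≤ b) (hcd : c ≤ d)
    {H : ℝ → ℝ → E →L[𝕜] E}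
    (hH : ContinuousOn (fun p : ℝ × ℝ => H p.1 p.2) (Set.Icc c d ×ˢ Set.Icc a b))
    (hΦ : ∀ t ∈ Set.Icc c d, ∀ s ∈ Set.Icc a b, H t s ∈ fredholmSelfAdjoint 𝕜 E)
    {Fa Fb : ℝ → ℤ} (hFa : IsSpectralPotential (fun t => H t a) c d Fa)
    (hFb : IsSpectralPotential (fun t => H t b) c d Fb) {m n : ℤ}
    (hm : HasSpectralFlow (H c) a b m) (hn : HasSpectralFlow (H d) a b n) :
    n - m = (Fb d - Fb c) - (Fa d - Fa c) := by
  have hrow : ∀ t ∈ Set.Icc c d, ContinuousOn (H t) (Set.Icc a b) := fun t ht =>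
    hH.comp (f := fun s => (t, s)) (by fun_prop) fun s hs => ⟨ht, hs⟩
  have hcol : ∀ s ∈ Set.Icc a b, ContinuousOn (fun t => H t s) (Set.Icc c d) := fun s hs =>
    hH.comp (f := fun t => (t, s)) (by fun_prop) fun t ht => ⟨ht, hs⟩
  -- The value `0` outside the interval only makes the flow of the row a function on all of `ℝ`.
  have hsf : ∀ t, ∃ k, t ∈ Set.Icc c d → HasSpectralFlow (H t) a b k := fun t => by
    by_cases ht : t ∈ Set.Icc c d
    · obtain ⟨k, hk⟩ := exists_hasSpectralFlow hab (hrow t ht) (hΦ t ht)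
      exact ⟨k, fun _ => hk⟩
    · exact ⟨0, fun h => absurd h ht⟩
  choose f hf using hsf
  have hc := Set.left_mem_Icc.2 hcd
  have hd := Set.right_mem_Icc.2 hcd
  have key := eq_of_eventually_eq_Icc (f := fun t => f t - Fb t + Fa t) (fun x hx => ?_) hc hd
  · have e1 := hm.unique hab (hrow c hc) (hΦ c hc) (hf c hc)
    have e2 := hn.unique hab (hrow d hd) (hΦ d hd) (hf d hd)
    linarith
  obtain ⟨N, t, ε, h0, hN, ht, hsum⟩ := hf x hx
  have htle := fun j hj => (ht j hj).1
  have htI : ∀ i ≤ N, t i ∈ Set.Icc a b := fun i hi =>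
    ⟨h0 ▸ le_of_forall_le_succ htle i.zero_le hi, hN ▸ le_of_forall_le_succ htle hi le_rfl⟩
  have hη : ∀ s, ∃ η, s ∈ Set.Icc a b → IsWindowAt (H x s) η := fun s => by
    by_cases hs : s ∈ Set.Icc a b
    · obtain ⟨η, h⟩ := exists_isWindowAt_of_mem (hΦ x hx s hs)
      exact ⟨η, fun _ => h⟩
    · exact ⟨0, fun h => absurd h hs⟩
  choose η hη using hη
  have hwin : ∀ i ∈ Finset.range N, ∀ᶠ y in 𝓝[Set.Icc c d] x,
      IsSpectralWindow (H y) (t i) (t (i + 1)) (ε i) := fun i hi => by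
    rw [Finset.mem_range] at hi
    have hsub : Set.Icc (t i) (t (i + 1)) ⊆ Set.Icc a b :=
      Set.Icc_subset_Icc (htI i hi.le).1 (htI (i + 1) hi).2
    -- The membership conditions sit inside the statement so that the compactness argument can use
    -- full neighbourhoods.
    have h1 : ∀ᶠ y in 𝓝 x, ∀ s ∈ Set.Icc (t i) (t (i + 1)),
        y ∈ Set.Icc c d → s ∈ Set.Icc a b → IsWindowAt (H y s) (ε i) := by
      refine isCompact_Icc.eventually_forall_of_forall_eventually fun s hs => ?_
      have hw := (isSpectralWindow_iff (htle i hi)).1 (ht i hi).2 s hs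
      have h2 := (hH (x, s) ⟨hx, hsub hs⟩).eventually (hw.eventually (hΦ x hx s (hsub hs)).1)
      filter_upwards [eventually_nhdsWithin_iff.1 h2] with p hp h3 h4
      exact hp ⟨h3, h4⟩
    filter_upwards [h1.filter_mono nhdsWithin_le_nhds, self_mem_nhdsWithin] with y hy hyI
    exact (isSpectralWindow_iff (htle i hi)).2 fun s hs => hy s hs hyI (hsub hs)
  have hstep : ∀ s ∈ Set.Icc a b, ∀ e, IsWindowAt (H x s) e → ∀ᶠ y in 𝓝[Set.Icc c d] x,
      (eigenvalueCount (H y s) e : ℤ) - eigenvalueCount (H x s) e =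
        eigenvalueCount (H y s) (η s) - eigenvalueCount (H x s) (η s) := fun s hs e he =>
    eventually_of_continuousOn (hcol s hs) (fun t ht => hΦ t ht s hs) hx
      (he.eventually_eigenvalueCount_sub (hΦ x hx s hs).1 (hη s hs))
  have hl : ∀ i ∈ Finset.range N, _ := fun i hi => hstep (t i)
    (htI i (Finset.mem_range.1 hi).le) (ε i) ((isSpectralWindow_iff
      (htle i (Finset.mem_range.1 hi))).1 (ht i (Finset.mem_range.1 hi)).2 _
      ⟨le_rfl, htle i (Finset.mem_range.1 hi)⟩)
  have hr : ∀ i ∈ Finset.range N, _ := fun i hi => hstep (t (i + 1))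
    (htI (i + 1) (Finset.mem_range.1 hi)) (ε i) ((isSpectralWindow_iff
      (htle i (Finset.mem_range.1 hi))).1 (ht i (Finset.mem_range.1 hi)).2 _
      ⟨htle i (Finset.mem_range.1 hi), le_rfl⟩)
  have haI : a ∈ Set.Icc a b := Set.left_mem_Icc.2 hab
  have hbI : b ∈ Set.Icc a b := Set.right_mem_Icc.2 hab
  filter_upwards [(Finset.eventually_all _).2 hwin, (Finset.eventually_all _).2 hl,
    (Finset.eventually_all _).2 hr, hFa x hx _ (hη a haI), hFb x hx _ (hη b hbI),
    self_mem_nhdsWithin] with y hw hl hr hya hyb hy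
  -- The subdivision and windows of the row `x` still compute the flow of the row `y`.
  have hfy : f y = ∑ i ∈ Finset.range N, ((eigenvalueCount (H y (t (i + 1))) (ε i) : ℤ) -
      eigenvalueCount (H y (t i)) (ε i)) :=
    (hf y hy).unique hab (hrow y hy) (hΦ y hy)
      ⟨N, t, ε, h0, hN, fun i hi => ⟨htle i hi, hw i (Finset.mem_range.2 hi)⟩, rfl⟩
  have hdiff : f y - f x = (eigenvalueCount (H y b) (η b) - eigenvalueCount (H x b) (η b)) -
      (eigenvalueCount (H y a) (η a) - eigenvalueCount (H x a) (η a)) := by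
    -- With one window `η s` per point `s`, the changes at interior subdivision points cancel and
    -- only those at `a` and `b` remain.
    rw [hfy, hsum, ← Finset.sum_sub_distrib, ← h0, ← hN,
      ← Finset.sum_range_sub (fun i => ((eigenvalueCount (H y (t i)) (η (t i)) : ℤ) -
        eigenvalueCount (H x (t i)) (η (t i))))]
    refine Finset.sum_congr rfl fun i hi => ?_
    linarith [hl i hi, hr i hi]
  linarith

theorem eventually_forall_isFredholm_shiftOp {X : Type*} [TopologicalSpace X] {A : X → E →L[𝕜] E}
    {K : Set X} (hK : IsCompact K) (hA : ContinuousOn A K)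
    (hΦ : ∀ p ∈ K, A p ∈ fredholmSelfAdjoint 𝕜 E) :
    ∀ᶠ μ : ℝ in 𝓝 0, ∀ p ∈ K, (shiftOp (A p) μ).IsFredholm := by
  have h : ∀ᶠ μ : ℝ in 𝓝 0, ∀ S ∈ A '' K, (shiftOp S μ).IsFredholm := by
    refine (hK.image_of_continuousOn hA).eventually_forall_of_forall_eventually ?_
    rintro _ ⟨p, hp, rfl⟩
    have := isFredholm_shiftOp_eventually (μ := 0) (hΦ p hp).1
      (by rw [shiftOp_zero]; exact (hΦ p hp).2)
    exact (continuous_swap.tendsto ((0 : ℝ), A p)).eventually this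
  exact h.mono fun μ hμ p hp => hμ _ ⟨p, hp, rfl⟩

theorem eventually_isUnit_shiftOp {T : E →L[𝕜] E} (hT : T ∈ fredholmSelfAdjoint 𝕜 E) :
    ∀ᶠ μ : ℝ in 𝓝[>] 0, IsUnit (shiftOp T μ) := by
  obtain ⟨r, hr, h⟩ := hT.2.exists_isUnit_shiftOp hT.1
  filter_upwards [Ioo_mem_nhdsGT hr] with μ hμ
  exact h μ hμ.1.ne' (by rw [abs_of_pos hμ.1]; exact hμ.2)

variable {L : ℝ → E →L[𝕜] E} {a b : ℝ}

theorem eventually_isAdmissibleShift (hab : a ≤ b) (hL : ContinuousOn L (Set.Icc a b))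
    (hΦ : ∀ s ∈ Set.Icc a b, L s ∈ fredholmSelfAdjoint 𝕜 E) :
    ∀ᶠ δ in 𝓝[>] 0, IsAdmissibleShift L a b δ := by
  have h := ((eventually_isUnit_shiftOp (hΦ a (Set.left_mem_Icc.2 hab))).and
    ((eventually_isUnit_shiftOp (hΦ b (Set.right_mem_Icc.2 hab))).and
    ((eventually_forall_isFredholm_shiftOp isCompact_Icc hL hΦ).filter_mono nhdsWithin_le_nhds)))
  obtain ⟨u, hu, hsub⟩ := mem_nhdsGT_iff_exists_Ioc_subset.1 h
  filter_upwards [Ioo_mem_nhdsGT hu] with δ hδ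
  exact ⟨hδ.1, fun μ hμ => hsub ⟨hμ.1, hμ.2.trans hδ.2.le⟩⟩

theorem IsAdmissibleShift.mem_fredholmSelfAdjoint {δ μ : ℝ} (h : IsAdmissibleShift L a b δ)
    (hΦ : ∀ s ∈ Set.Icc a b, L s ∈ fredholmSelfAdjoint 𝕜 E) (hμ : μ ∈ Set.Ioc 0 δ) {s : ℝ}
    (hs : s ∈ Set.Icc a b) : shiftOp (L s) μ ∈ fredholmSelfAdjoint 𝕜 E :=
  shiftOp_mem_fredholmSelfAdjoint (hΦ s hs).1 ((h.2 μ hμ).2.2 s hs)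

theorem HasSpectralFlow.eq_of_isAdmissibleShift (hab : a ≤ b) (hL : ContinuousOn L (Set.Icc a b))
    (hΦ : ∀ s ∈ Set.Icc a b, L s ∈ fredholmSelfAdjoint 𝕜 E) {δ₁ δ₂ : ℝ} (hδ : δ₁ ≤ δ₂)
    (h₁ : IsAdmissibleShift L a b δ₁) (h₂ : IsAdmissibleShift L a b δ₂) {m n : ℤ}
    (hm : HasSpectralFlow (fun s => shiftOp (L s) δ₁) a b m)
    (hn : HasSpectralFlow (fun s => shiftOp (L s) δ₂) a b n) : m = n := by
  have hμ : ∀ μ ∈ Set.Icc δ₁ δ₂, μ ∈ Set.Ioc 0 δ₂ := fun μ hμ => ⟨h₁.1.trans_le hμ.1, hμ.2⟩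
  have hΦ' : ∀ μ ∈ Set.Icc δ₁ δ₂, ∀ s ∈ Set.Icc a b,
      shiftOp (L s) μ ∈ fredholmSelfAdjoint 𝕜 E := fun μ h s hs =>
    h₂.mem_fredholmSelfAdjoint hΦ (hμ μ h) hs
  have hcol : ∀ s, ContinuousOn (fun μ => shiftOp (L s) μ) (Set.Icc δ₁ δ₂) := fun s =>
    continuousOn_const.shiftOp continuousOn_id
  have haI : a ∈ Set.Icc a b := Set.left_mem_Icc.2 hab
  have hbI : b ∈ Set.Icc a b := Set.right_mem_Icc.2 hab
  obtain ⟨Fa, hFa⟩ := exists_isSpectralPotential hδ (hcol a) fun μ h => hΦ' μ h a haI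
  obtain ⟨Fb, hFb⟩ := exists_isSpectralPotential hδ (hcol b) fun μ h => hΦ' μ h b hbI
  have h := hm.sub_eq_of_homotopy (H := fun μ s => shiftOp (L s) μ) hab hδ
    ((hL.comp continuousOn_snd fun p hp => hp.2).shiftOp continuousOn_fst) hΦ' hFa hFb hn
  rw [hFa.eq_of_isUnit (hcol a) (fun μ h => hΦ' μ h a haI) (fun μ h => (h₂.2 μ (hμ μ h)).1) hδ,
    hFb.eq_of_isUnit (hcol b) (fun μ h => hΦ' μ h b hbI) (fun μ h => (h₂.2 μ (hμ μ h)).2.1) hδ]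
    at h
  linarith

/-- The extended spectral flow exists and is unique. -/
theorem existsUnique_hasExtendedSpectralFlow (hab : a ≤ b) (hL : ContinuousOn L (Set.Icc a b))
    (hΦ : ∀ s ∈ Set.Icc a b, L s ∈ fredholmSelfAdjoint 𝕜 E) :
    ∃! n, HasExtendedSpectralFlow L a b n := by
  refine existsUnique_of_exists_of_unique ?_ ?_
  · obtain ⟨δ, hδ⟩ := (eventually_isAdmissibleShift hab hL hΦ).exists
    obtain ⟨n, hn⟩ := exists_hasSpectralFlow hab (hL.shiftOp (continuousOn_const (c := δ)))
      fun s hs => hδ.mem_fredholmSelfAdjoint hΦ ⟨hδ.1, le_rfl⟩ hs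
    exact ⟨n, δ, hδ, hn⟩
  · rintro m n ⟨δ₁, h₁, hm⟩ ⟨δ₂, h₂, hn⟩
    rcases le_total δ₁ δ₂ with h | h
    · exact hm.eq_of_isAdmissibleShift hab hL hΦ h h₁ h₂ hn
    · exact (hn.eq_of_isAdmissibleShift hab hL hΦ h h₂ h₁ hm).symm

theorem HasExtendedSpectralFlow.extendedSpectralFlow_eq (hab : a ≤ b)
    (hL : ContinuousOn L (Set.Icc a b)) (hΦ : ∀ s ∈ Set.Icc a b, L s ∈ fredholmSelfAdjoint 𝕜 E)
    {n : ℤ} (h : HasExtendedSpectralFlow L a b n) : extendedSpectralFlow L a b = n := by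
  have hex : ∃ n, HasExtendedSpectralFlow L a b n := ⟨n, h⟩
  rw [extendedSpectralFlow, dif_pos hex]
  exact (existsUnique_hasExtendedSpectralFlow hab hL hΦ).unique hex.choose_spec h

omit [CompleteSpace E] in
theorem shiftOp_le_shiftOp {S T : E →L[𝕜] E} (h : S ≤ T) (μ : ℝ) : shiftOp S μ ≤ shiftOp T μ := by
  rw [ContinuousLinearMap.le_def] at h ⊢
  rwa [shiftOp, shiftOp, add_sub_add_right_eq_sub]

end SpectralFlow

theorem theorem6p1 {𝕜 E : Type*} [RCLike 𝕜] [NormedAddCommGroup E] [InnerProductSpace 𝕜 E]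
    [CompleteSpace E] (a b : ℝ) (hab : a ≤ b) (H : ℝ → ℝ → E →L[𝕜] E)
    (hcont : ContinuousOn (fun p : ℝ × ℝ => H p.1 p.2) (Set.Icc 0 1 ×ˢ Set.Icc a b))
    (hfred : ∀ t ∈ Set.Icc (0 : ℝ) 1, ∀ s ∈ Set.Icc a b, H t s ∈ fredholmSelfAdjoint 𝕜 E)
    (ha : AntitoneOn (fun t => H t a) (Set.Icc 0 1))
    (hb : MonotoneOn (fun t => H t b) (Set.Icc 0 1)) :
    (∃! m : ℤ, HasExtendedSpectralFlow (H 0) a b m) ∧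
    (∃! n : ℤ, HasExtendedSpectralFlow (H 1) a b n) ∧
    extendedSpectralFlow (H 0) a b ≤ extendedSpectralFlow (H 1) a b := by
  have h0 : (0 : ℝ) ∈ Set.Icc (0 : ℝ) 1 := ⟨le_rfl, zero_le_one⟩
  have h1 : (1 : ℝ) ∈ Set.Icc (0 : ℝ) 1 := ⟨zero_le_one, le_rfl⟩
  have haI : a ∈ Set.Icc a b := Set.left_mem_Icc.2 hab
  have hbI : b ∈ Set.Icc a b := Set.right_mem_Icc.2 hab
  have hrow : ∀ t ∈ Set.Icc (0 : ℝ) 1, ContinuousOn (H t) (Set.Icc a b) := fun t ht =>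
    hcont.comp (f := fun s => (t, s)) (by fun_prop) fun s hs => ⟨ht, hs⟩
  refine ⟨existsUnique_hasExtendedSpectralFlow hab (hrow 0 h0) (hfred 0 h0),
    existsUnique_hasExtendedSpectralFlow hab (hrow 1 h1) (hfred 1 h1), ?_⟩
  -- A single `δ` serves both rows and the whole rectangle, by compactness.
  obtain ⟨δ, hδ0, hδ1, hδF⟩ := ((eventually_isAdmissibleShift hab (hrow 0 h0) (hfred 0 h0)).and
    ((eventually_isAdmissibleShift hab (hrow 1 h1) (hfred 1 h1)).and
    ((eventually_forall_isFredholm_shiftOp (isCompact_Icc.prod isCompact_Icc) hcont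
      fun p hp => hfred p.1 hp.1 p.2 hp.2).filter_mono nhdsWithin_le_nhds))).exists
  have hΦ : ∀ t ∈ Set.Icc (0 : ℝ) 1, ∀ s ∈ Set.Icc a b,
      shiftOp (H t s) δ ∈ fredholmSelfAdjoint 𝕜 E := fun t ht s hs =>
    shiftOp_mem_fredholmSelfAdjoint (hfred t ht s hs).1 (hδF (t, s) ⟨ht, hs⟩)
  have hcont' : ContinuousOn (fun p : ℝ × ℝ => shiftOp (H p.1 p.2) δ)
      (Set.Icc 0 1 ×ˢ Set.Icc a b) := hcont.shiftOp continuousOn_const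
  have hcol : ∀ s ∈ Set.Icc a b, ContinuousOn (fun t => shiftOp (H t s) δ) (Set.Icc 0 1) :=
    fun s hs => hcont'.comp (f := fun t => (t, s)) (by fun_prop) fun t ht => ⟨ht, hs⟩
  have hrow' : ∀ t ∈ Set.Icc (0 : ℝ) 1,
      ContinuousOn (fun s => shiftOp (H t s) δ) (Set.Icc a b) := fun t ht =>
    (hrow t ht).shiftOp continuousOn_const
  obtain ⟨m, hm⟩ := exists_hasSpectralFlow hab (hrow' 0 h0) (hΦ 0 h0)
  obtain ⟨n, hn⟩ := exists_hasSpectralFlow hab (hrow' 1 h1) (hΦ 1 h1)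
  obtain ⟨Fa, hFa⟩ := exists_isSpectralPotential zero_le_one (hcol a haI)
    fun t ht => hΦ t ht a haI
  obtain ⟨Fb, hFb⟩ := exists_isSpectralPotential zero_le_one (hcol b hbI)
    fun t ht => hΦ t ht b hbI
  have key := hm.sub_eq_of_homotopy (H := fun t s => shiftOp (H t s) δ) hab zero_le_one hcont' hΦ
    hFa hFb hn
  have hFa' := hFa.le_of_antitoneOn (hcol a haI) (fun t ht => hΦ t ht a haI) zero_le_one
    fun s hs t ht hst => shiftOp_le_shiftOp (ha hs ht hst) δ
  have hFb' := hFb.le_of_monotoneOn (hcol b hbI) (fun t ht => hΦ t ht b hbI) zero_le_one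
    fun s hs t ht hst => shiftOp_le_shiftOp (hb hs ht hst) δ
  rw [HasExtendedSpectralFlow.extendedSpectralFlow_eq hab (hrow 0 h0) (hfred 0 h0) ⟨δ, hδ0, hm⟩,
    HasExtendedSpectralFlow.extendedSpectralFlow_eq hab (hrow 1 h1) (hfred 1 h1) ⟨δ, hδ1, hn⟩]
  linarith
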